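/- Write $\mathbb{R}_+=[0,\infty)$ and $\mathbb{R}_{++}=(0,\infty)$; "increasing" and "decreasing" are meant strictly. Let $W_1$ be the set of locally integrable functions $c:\mathbb{R}_+\to\mathbb{R}_+$ and $W_2$ the set of measurable, locally bounded functions $c:\mathbb{R}_+\to\mathbb{R}_+$. Assume the following. (1) $\rho>0$, and $W$ is either $W_1$ or $W_2$. (2) $u:\mathbb{R}_+^2\to\mathbb{R}\cup\{-\infty\}$, $(c,k)\mapsto u(c,k)$, is continuous, concave and nondecreasing; on $\mathbb{R}_{++}^2$ it is increasing in $c$ and continuously differentiable; and there is $c>0$ with $u(c,0)>-\infty$. (3) $F:\mathbb{R}_+^2\to\mathbb{R}$, $(k,c)\mapsto F(k,c)$, is continuous and concave, $F(0,0)=0$, and $F$ is decreasing in $c$. There are $d_1>0$ and an increasing $\delta_2:\mathbb{R}_+\to\mathbb{R}_+$ with $\delta_2(0)=0$ such that $F(k,c)>-d_1k-\delta_2(c)$ for all $k>0$, $c\ge 0$; if $W=W_1$, then $\delta_2(c)=d_2c$ for some $d_2\ge 0$ and all $c\geq 0$. For every $c\ge 0$ there is $k>0$ with $F(k,c)>F(0,c)$.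 (4) $\frac{\partial u}{\partial c}(c,k)$ is decreasing in $c$ on $\mathbb{R}_{++}^2$, and for every $k>0$: $\lim_{c\to 0}\frac{\partial u}{\partial c}(c,k)=+\infty$, $\lim_{c\to\infty}\frac{\partial u}{\partial c}(c,k)=0$ and $\limsup_{c\downarrow 0}\frac{\partial u}{\partial k}(c,k)<+\infty$. (5) There is $\varepsilon_0>0$ such that $\frac{\partial u}{\partial c}$ is continuously differentiable in $k$ on $\{(c,k): c>0,\ 0<k<\varepsilon_0\}$, and there is a continuously differentiable $H:(0,\varepsilon_0)\times\mathbb{R}_{++}\to\mathbb{R}$ with $\frac{\partial H}{\partial k}(k,c)>0$ and $\frac{\partial H}{\partial c}(k,c)<0$ everywhere such that, whenever $0<k<\varepsilon_0$, $c>0$ and $H(k,c)\ne 0$, $F$ is continuously differentiable in $c$ and $\frac{\partial F}{\partial c}$ is continuously differentiable in $k$ around $(k,c)$. Moreover, there is $k>0$ with $\inf_{c\ge 0}D_{k,+}F(k,c)>\rho$, where $D_{k,+}F(k,c)=\sup_{t>0}\frac{F(k+t,c)-F(k,c)}{t}$. For $p,k>0$ let $c^*(p,k)$ be the (unique, under these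 assumptions) maximizer of $c\mapsto F(k,c)p+u(c,k)$ over $c\ge 0$. For $V:\mathbb{R}_{++}\to\mathbb{R}$ and $k>0$ let $\partial V(k)=\{p: V(y)-V(k)\le p(y-k)\ \forall y>0\}$ and $c^*(\partial V(k),k)=\{c^*(p,k):p\in\partial V(k)\}$. Let $k^+(\cdot,\bar k)$ be the solution on $\mathbb{R}_+$ of $\dot k=F(k,0)$, $k(0)=\bar k$. Let $\mathscr{V}$ be the set of increasing concave $V:\mathbb{R}_{++}\to\mathbb{R}$ with $\lim_{T\to\infty}e^{-\rho T}V(k^+(T,\bar k))=0$ for every $\bar k>0$. A continuous $V:\mathbb{R}_{++}\to\mathbb{R}$ is a viscosity solution of the Hamilton–Jacobi–Bellman equation $\sup_{c\ge 0}\{F(k,c)V'(k)+u(c,k)\}-\rho V(k)=0$ if for every $k>0$ and every continuously differentiable $\varphi$ on a neighbourhood of $k$ in $\mathbb{R}_{++}$ with $\varphi(k)=V(k)$: $\sup_{c\ge 0}\{F(k,c)\varphi'(k)+u(c,k)\}-\rho V(k)$ is $\le 0$ if $\varphi\le V$ on the domain of $\varphi$, and is $\ge 0$ if $\varphi\ge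 V$ on the domain of $\varphi$. For $\bar k>0$ let $B_{\bar k}$ be the set of pairs of nonnegative functions $(k(t),c(t))$ on $\mathbb{R}_+$ such that $k$ is absolutely continuous on compact intervals, $c\in W$, $k(0)=\bar k$, $\dot k(t)=F(k(t),c(t))$ for almost all $t\geq 0$, and $\lim_{T\to\infty}\int_0^Te^{-\rho t}u(c(t),k(t))\,dt$ exists in $[-\infty,\infty]$. Let $V\in\mathscr{V}$ be a viscosity solution of the Hamilton–Jacobi–Bellman equation and let $\bar k>0$. Then: (a) The differential inclusion $$\dot k(t)\in F\bigl(k(t),c^*(\partial V(k(t)),k(t))\bigr)\ \text{ for almost all } t,\qquad k(0)=\bar k,$$ has a solution $k^*:\mathbb{R}_+\to\mathbb{R}_{++}$ that is absolutely continuous on compact intervals. (b) Every such solution $k^*$ on $\mathbb{R}_+$ satisfies $\inf_{t\ge 0}k^*(t)>0$. Moreover, for every $t\ge 0$ the distance $\bigl|\limsup_{n\to\infty}n\bigl(k^*(t+n^{-1})-k^*(t)\bigr)-c\bigr|$ has a unique minimizer $c=c^*(t)$ over $c\in c^*(\partial V(k^*(t)),k^*(t))$; the function $c^*(\cdot)$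 so defined is locally bounded, $(k^*,c^*)\in B_{\bar k}$, and $$V(\bar k)=\lim_{T\to\infty}\int_0^Te^{-\rho t}u(c^*(t),k^*(t))\,dt.$$ (c) For every $(k(t),c(t))\in B_{\bar k}$ with $\inf_{t\ge 0}k(t)>0$, $$\lim_{T\to\infty}\int_0^Te^{-\rho t}u(c(t),k(t))\,dt\le V(\bar k).$$ -/

import Mathlib

open MeasureTheory Filter Topology Set

noncomputable section

namespace EconGrowth

/-! Time runs over `[0, ∞)`; a path is a function `ℝ → ℝ` of which only the values at `t ≥ 0`
matter. The utility function `u : ℝ → ℝ → EReal` takes its arguments in the order `(c, k)`, the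
technology function `F : ℝ → ℝ → ℝ` in the order `(k, c)`; only their values on the closed
positive quadrant matter. -/

/-- The closed positive quadrant. -/
def quadrant : Set (ℝ × ℝ) := Ici 0 ×ˢ Ici 0

/-- The open positive quadrant. -/
def openQuadrant : Set (ℝ × ℝ) := Ioi 0 ×ˢ Ioi 0

/-- A path is bounded on every compact subinterval of `[0, ∞)`. -/
def LocallyBounded (c : ℝ → ℝ) : Prop :=
  ∀ T : ℝ, 0 ≤ T → ∃ M : ℝ, ∀ t ∈ Icc 0 T, |c t| ≤ M

/-- Nonnegative locally integrable functions on `[0, ∞)`. -/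
def W₁ : Set (ℝ → ℝ) :=
  {c | (∀ t, 0 ≤ t → 0 ≤ c t) ∧ ∀ T : ℝ, 0 ≤ T → IntegrableOn c (Icc 0 T) volume}

/-- Nonnegative, (Lebesgue) measurable, locally bounded functions on `[0, ∞)`. -/
def W₂ : Set (ℝ → ℝ) :=
  {c | (∀ t, 0 ≤ t → 0 ≤ c t) ∧ AEMeasurable c (volume.restrict (Ici 0)) ∧ LocallyBounded c}

/-- Absolute continuity on every compact subinterval of `[0, ∞)`. -/
def LocallyAC (k : ℝ → ℝ) : Prop :=
  ∀ T : ℝ, 0 ≤ T → AbsolutelyContinuousOnInterval k 0 T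

/-! ### The primitives -/

/-- `∂u/∂c (c, k)` (used only on the open quadrant, where `u` is finite). -/
def uc (u : ℝ → ℝ → EReal) (c k : ℝ) : ℝ := deriv (fun x => (u x k).toReal) c

/-- `∂u/∂k (c, k)` (used only on the open quadrant, where `u` is finite). -/
def uk (u : ℝ → ℝ → EReal) (c k : ℝ) : ℝ := deriv (fun x => (u c x).toReal) k

/-- The standing assumption on the instantaneous utility function
`u : ℝ₊² → ℝ ∪ {-∞}`. -/
structure UtilityAssumption (u : ℝ → ℝ → EReal) : Prop where
  ne_top : ∀ c k, 0 ≤ c → 0 ≤ k → u c k ≠ ⊤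
  continuousOn : ContinuousOn (fun x : ℝ × ℝ => u x.1 x.2) quadrant
  concave : ∀ x ∈ quadrant, ∀ y ∈ quadrant, ∀ a b : ℝ, 0 < a → 0 < b → a + b = 1 →
    (a : EReal) * u x.1 x.2 + (b : EReal) * u y.1 y.2
      ≤ u (a * x.1 + b * y.1) (a * x.2 + b * y.2)
  nondecreasing : ∀ c c' k k', 0 ≤ c → c ≤ c' → 0 ≤ k → k ≤ k' → u c k ≤ u c' k'
  increasing : ∀ k, 0 < k → StrictMonoOn (fun c => u c k) (Ioi 0)
  contDiffOn : ContDiffOn ℝ 1 (fun x : ℝ × ℝ => (u x.1 x.2).toReal) openQuadrant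
  finite_at_zero_capital : ∃ c, 0 < c ∧ u c 0 ≠ ⊥

/-- The standing assumption on the technology function `F : ℝ₊² → ℝ`. -/
structure TechnologyAssumption (W : Set (ℝ → ℝ)) (F : ℝ → ℝ → ℝ) : Prop where
  continuousOn : ContinuousOn (fun x : ℝ × ℝ => F x.1 x.2) quadrant
  concave : ConcaveOn ℝ quadrant (fun x : ℝ × ℝ => F x.1 x.2)
  zero : F 0 0 = 0
  decreasing : ∀ k, 0 ≤ k → StrictAntiOn (fun c => F k c) (Ici 0)
  lower_bound : ∃ d₁ : ℝ, 0 < d₁ ∧ ∃ δ₂ : ℝ → ℝ, StrictMonoOn δ₂ (Ici 0) ∧ δ₂ 0 = 0 ∧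
    (∀ k c, 0 < k → 0 ≤ c → -d₁ * k - δ₂ c < F k c) ∧
    (W = W₁ → ∃ d₂ : ℝ, 0 ≤ d₂ ∧ ∀ c, 0 ≤ c → δ₂ c = d₂ * c)
  productive : ∀ c, 0 ≤ c → ∃ k, 0 < k ∧ F 0 c < F k c

/-- The standing assumption on the marginal utilities. -/
structure MarginalUtilityAssumption (u : ℝ → ℝ → EReal) : Prop where
  uc_decreasing : ∀ k, 0 < k → StrictAntiOn (fun c => uc u c k) (Ioi 0)
  uc_zero : ∀ k, 0 < k → Tendsto (fun c => uc u c k) (𝓝[>] 0) atTop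
  uc_infty : ∀ k, 0 < k → Tendsto (fun c => uc u c k) atTop (𝓝 0)
  uk_zero : ∀ k, 0 < k → limsup (fun c => (uk u c k : EReal)) (𝓝[>] 0) < ⊤

/-- `∂F/∂c (k, c)`. -/
def Fc (F : ℝ → ℝ → ℝ) (k c : ℝ) : ℝ := deriv (fun x => F k x) c

/-- The partial right-derivative of `F` in `k`, as the supremum of the difference quotients. -/
def rightDerivK (F : ℝ → ℝ → ℝ) (k c : ℝ) : EReal :=
  ⨆ t : ℝ, ⨆ _ : 0 < t, (((F (k + t) c - F k c) / t : ℝ) : EReal)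

/-- Regularity of `u` and `F` near zero capital, and high marginal productivity of capital at
some capital level. -/
structure LowCapitalAssumption (ρ : ℝ) (u : ℝ → ℝ → EReal) (F : ℝ → ℝ → ℝ) : Prop where
  regular : ∃ ε₀ : ℝ, 0 < ε₀ ∧
    (∀ c k, 0 < c → k ∈ Ioo 0 ε₀ → DifferentiableAt ℝ (fun x => uc u c x) k) ∧
    ContinuousOn (fun x : ℝ × ℝ => deriv (fun y => uc u x.1 y) x.2) (Ioi 0 ×ˢ Ioo 0 ε₀) ∧
    ∃ H : ℝ → ℝ → ℝ,
      ContDiffOn ℝ 1 (fun x : ℝ × ℝ => H x.1 x.2) (Ioo 0 ε₀ ×ˢ Ioi 0) ∧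
      (∀ k c, k ∈ Ioo 0 ε₀ → 0 < c →
        0 < deriv (fun x => H x c) k ∧ deriv (fun x => H k x) c < 0) ∧
      ∀ k c, k ∈ Ioo 0 ε₀ → 0 < c → H k c ≠ 0 →
        ∀ᶠ x : ℝ × ℝ in 𝓝 (k, c),
          DifferentiableAt ℝ (fun y => F x.1 y) x.2 ∧
          ContinuousAt (fun z : ℝ × ℝ => Fc F z.1 z.2) x ∧
          DifferentiableAt ℝ (fun y => Fc F y x.2) x.1 ∧
          ContinuousAt (fun z : ℝ × ℝ => deriv (fun y => Fc F y z.2) z.1) x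
  productivity : ∃ k : ℝ, 0 < k ∧ (ρ : EReal) < ⨅ c : ℝ, ⨅ _ : 0 ≤ c, rightDerivK F k c

/-! ### The Hamilton-Jacobi-Bellman equation -/

/-- The superdifferential of a concave function on `(0, ∞)`. -/
def superdiff (V : ℝ → ℝ) (k : ℝ) : Set ℝ :=
  {p | ∀ y, 0 < y → V y - V k ≤ p * (y - k)}

/-- `sup_{c ≥ 0} {F(k,c) p + u(c,k)}`. -/
def hamiltonian (u : ℝ → ℝ → EReal) (F : ℝ → ℝ → ℝ) (p k : ℝ) : EReal :=
  ⨆ c : ℝ, ⨆ _ : 0 ≤ c, ((F k c * p : ℝ) : EReal) + u c k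

/-- Viscosity subsolutions, with the sign convention of maximization problems:
test functions touch `V` from below. -/
def IsViscositySubsolution (ρ : ℝ) (u : ℝ → ℝ → EReal) (F : ℝ → ℝ → ℝ) (V : ℝ → ℝ) : Prop :=
  UpperSemicontinuousOn V (Ioi 0) ∧
  ∀ k : ℝ, 0 < k → ∀ (U : Set ℝ) (φ : ℝ → ℝ), IsOpen U → k ∈ U → U ⊆ Ioi 0 →
    ContDiffOn ℝ 1 φ U → φ k = V k → (∀ k' ∈ U, φ k' ≤ V k') →
    hamiltonian u F (deriv φ k) k ≤ ((ρ * V k : ℝ) : EReal)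

/-- Viscosity supersolutions: test functions touch `V` from above. -/
def IsViscositySupersolution (ρ : ℝ) (u : ℝ → ℝ → EReal) (F : ℝ → ℝ → ℝ) (V : ℝ → ℝ) : Prop :=
  LowerSemicontinuousOn V (Ioi 0) ∧
  ∀ k : ℝ, 0 < k → ∀ (U : Set ℝ) (φ : ℝ → ℝ), IsOpen U → k ∈ U → U ⊆ Ioi 0 →
    ContDiffOn ℝ 1 φ U → φ k = V k → (∀ k' ∈ U, V k' ≤ φ k') →
    ((ρ * V k : ℝ) : EReal) ≤ hamiltonian u F (deriv φ k) k

/-- Viscosity solutions of `sup_{c ≥ 0} {F(k,c) V'(k) + u(c,k)} - ρ V(k) = 0` on `(0, ∞)`. -/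
def IsViscositySolution (ρ : ℝ) (u : ℝ → ℝ → EReal) (F : ℝ → ℝ → ℝ) (V : ℝ → ℝ) : Prop :=
  ContinuousOn V (Ioi 0) ∧ IsViscositySubsolution ρ u F V ∧ IsViscositySupersolution ρ u F V

/-- `κ` is the pure accumulation path from `k₀`: the solution on `[0, ∞)` of
`κ' = F(κ, 0)`, `κ(0) = k₀`. -/
def IsPureAccumulationPath (F : ℝ → ℝ → ℝ) (k₀ : ℝ) (κ : ℝ → ℝ) : Prop :=
  (∀ t, 0 ≤ t → 0 ≤ κ t) ∧ LocallyAC κ ∧ κ 0 = k₀ ∧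
  ∀ᵐ t ∂(volume.restrict (Ici 0)), HasDerivAt κ (F (κ t) 0) t

/-- The class of increasing concave functions on `(0, ∞)` with
`e^{-ρT} V(k⁺(T, k₀)) → 0` along the pure accumulation path from every `k₀ > 0`. -/
structure GrowthClass (ρ : ℝ) (F : ℝ → ℝ → ℝ) (V : ℝ → ℝ) : Prop where
  increasing : StrictMonoOn V (Ioi 0)
  concave : ConcaveOn ℝ (Ioi 0) V
  growth : ∀ k₀, 0 < k₀ → ∀ κ, IsPureAccumulationPath F k₀ κ →
    Tendsto (fun T => Real.exp (-ρ * T) * V (κ T)) atTop (𝓝 0)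

/-! ### Discounted utility and the class of feasible pairs -/

/-- Discounted instantaneous utility `e^{-ρt} u(c(t), k(t))`. -/
def flow (ρ : ℝ) (u : ℝ → ℝ → EReal) (k c : ℝ → ℝ) (t : ℝ) : EReal :=
  (Real.exp (-ρ * t) : EReal) * u (c t) (k t)

/-- Integral over `[0, T]` of the positive part of the discounted utility. -/
def posUtility (ρ : ℝ) (u : ℝ → ℝ → EReal) (k c : ℝ → ℝ) (T : ℝ) : ENNReal :=
  ∫⁻ t in Icc 0 T, (flow ρ u k c t).toENNReal

/-- Integral over `[0, T]` of the negative part of the discounted utility. -/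
def negUtility (ρ : ℝ) (u : ℝ → ℝ → EReal) (k c : ℝ → ℝ) (T : ℝ) : ENNReal :=
  ∫⁻ t in Icc 0 T, (-flow ρ u k c t).toENNReal

/-- `∫₀ᵀ e^{-ρt} u(c(t), k(t)) dt` as an extended real number; meaningful if one of the two parts
is finite. -/
def utility (ρ : ℝ) (u : ℝ → ℝ → EReal) (k c : ℝ → ℝ) (T : ℝ) : EReal :=
  (posUtility ρ u k c T : EReal) - (negUtility ρ u k c T : EReal)

/-- The pairs `(k, c)` of nonnegative paths with `k` locally absolutely continuous, `c ∈ W`,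
`k(0) = k₀`, `k' = F(k, c)` almost everywhere, and such that
`lim_{T → ∞} ∫₀ᵀ e^{-ρt} u(c(t), k(t)) dt` exists in `[-∞, ∞]`. -/
def B (ρ : ℝ) (W : Set (ℝ → ℝ)) (u : ℝ → ℝ → EReal) (F : ℝ → ℝ → ℝ) (k₀ : ℝ) :
    Set ((ℝ → ℝ) × (ℝ → ℝ)) :=
  {x | (∀ t, 0 ≤ t → 0 ≤ x.1 t ∧ 0 ≤ x.2 t) ∧ LocallyAC x.1 ∧ x.2 ∈ W ∧
    (∀ T, 0 ≤ T → posUtility ρ u x.1 x.2 T ≠ ⊤ ∨ negUtility ρ u x.1 x.2 T ≠ ⊤) ∧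
    (∃ L : EReal, Tendsto (utility ρ u x.1 x.2) atTop (𝓝 L)) ∧
    x.1 0 = k₀ ∧
    ∀ᵐ t ∂(volume.restrict (Ici 0)), HasDerivAt x.1 (F (x.1 t) (x.2 t)) t}

/-- `inf_{t ≥ 0} k(t) > 0`. -/
def BoundedAwayFromZero (k : ℝ → ℝ) : Prop := ∃ ε : ℝ, 0 < ε ∧ ∀ t, 0 ≤ t → ε ≤ k t

/-! ### The differential inclusion -/

/-- The set of maximizers of `c ↦ F(k,c) p + u(c,k)` over `c ≥ 0`; for `p, k > 0` and under the
standing assumptions this is the one-point set `{c*(p, k)}`. -/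
def maximizers (u : ℝ → ℝ → EReal) (F : ℝ → ℝ → ℝ) (p k : ℝ) : Set ℝ :=
  {c | 0 ≤ c ∧ ((F k c * p : ℝ) : EReal) + u c k = hamiltonian u F p k}

/-- The set `c*(∂V(k), k)`. -/
def policy (u : ℝ → ℝ → EReal) (F : ℝ → ℝ → ℝ) (V : ℝ → ℝ) (k : ℝ) : Set ℝ :=
  ⋃ p ∈ superdiff V k, maximizers u F p k

/-- `k : [0, ∞) → (0, ∞)` is a solution on all of `[0, ∞)` of the differential inclusion
`k' ∈ Γ(k)`, `k(0) = k₀`. -/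
def IsGlobalSolution (Γ : ℝ → Set ℝ) (k₀ : ℝ) (k : ℝ → ℝ) : Prop :=
  (∀ t, 0 ≤ t → 0 < k t) ∧ LocallyAC k ∧ k 0 = k₀ ∧
  ∀ᵐ t ∂(volume.restrict (Ici 0)), ∃ y ∈ Γ (k t), HasDerivAt k y t

/-- `limsup_{n → ∞} n (k(t + 1/n) - k(t))`, as an extended real number. -/
def forwardSlope (k : ℝ → ℝ) (t : ℝ) : EReal :=
  limsup (fun n : ℕ => ((n * (k (t + (n : ℝ)⁻¹) - k t) : ℝ) : EReal)) atTop

/-- The set of minimizers of `|limsup_n n (k(t + 1/n) - k(t)) - c|` over `c ∈ S`. -/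
def nearest (S : Set ℝ) (k : ℝ → ℝ) (t : ℝ) : Set ℝ :=
  {c | c ∈ S ∧ ∀ c' ∈ S, (forwardSlope k t - (c : EReal)).abs ≤ (forwardSlope k t - (c' : EReal)).abs}

end EconGrowth

end

open EconGrowth

/-!
The key point is that a concave viscosity solution `V` solves the Hamilton–Jacobi–Bellman equation
in the classical sense with *every* element of its superdifferential in place of `V'`
(`hamiltonian_eq`). Touching `V` from below by parabolas gives the subsolution inequality on a dense
set, hence at the two extreme elements of each superdifferential by passing to limits from either
side, and then on all of it because the Hamiltonian is convex in the costate; affine functions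
touching from above give the reverse inequality.

The Hamiltonian being constant on the superdifferential, and a supremum of functions affine in the
costate, its maximizer is the same for all costates in the superdifferential
(`maximizers_eq_of_mem_superdiff`). So the set `c*(∂V(k), k)` is a single point, the feedback
consumption, which depends continuously on `k` (`continuousOn_feedback`), and the differential
inclusion is an ordinary differential equation `k' = f(k)` with continuous right-hand side
`f(k) = F(k, c(k))`. Comparing the equation at two nearby capital levels shows that `f > 0` wherever
the marginal product of capital exceeds `ρ`, in particular near `0` (`technology_feedback_pos`).
This keeps every solution away from `0`, and with the linear growth bound inherited from `F(·, 0)`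
it yields global existence by Peano's theorem (`exists_positive_solution`).

For a feasible path that stays away from `0`, the discounted value `e^{-ρt} V(k(t))` is absolutely
continuous and satisfies the chain rule almost everywhere with any element of the
superdifferential (`ae_deriv_discountedValue`). The Hamilton–Jacobi–Bellman equation bounds the
discounted utility by the rate at which this quantity falls, with equality under the feedback
(`utility_le`, `utility_feedback_eq`). Letting the horizon grow, the remaining term
`e^{-ρT} V(k(T))` is asymptotically nonnegative, and under the feedback it vanishes because `k` is
dominated by pure accumulation (`tendsto_discountedValue`).
-/

noncomputable section

namespace EconGrowth

/-! ### Ordinary differential equations on the line -/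

/-- The explicit Euler scheme with step `h` for `x' = f x`. -/
def eulerIter (f : ℝ → ℝ) (h x₀ : ℝ) (j : ℕ) : ℝ := (fun x => x + h * f x)^[j] x₀

theorem eulerIter_succ (f : ℝ → ℝ) (h x₀ : ℝ) (j : ℕ) :
    eulerIter f h x₀ (j + 1) = eulerIter f h x₀ j + h * f (eulerIter f h x₀ j) := by
  simp only [eulerIter, Function.iterate_succ_apply']

/-- The discrete Grönwall bound for the Euler scheme. -/
theorem abs_eulerIter_le {f : ℝ → ℝ} {C h x₀ : ℝ} (hC : 0 ≤ C) (hh : 0 ≤ h)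
    (hf : ∀ x, |f x| ≤ C * (1 + |x|)) (j : ℕ) :
    |eulerIter f h x₀ j| ≤ (1 + |x₀|) * Real.exp (C * (h * j)) - 1 := by
  induction j with
  | zero => simp [eulerIter]
  | succ j ih =>
    rw [eulerIter_succ]
    set a := eulerIter f h x₀ j
    have h1 : |a + h * f a| ≤ |a| + h * (C * (1 + |a|)) := by
      refine (abs_add_le _ _).trans ?_
      rw [abs_mul, abs_of_nonneg hh]
      gcongr
      exact hf a
    have h2 : Real.exp (C * (h * (j + 1 : ℕ))) = Real.exp (C * (h * j)) * Real.exp (C * h) := by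
      rw [← Real.exp_add]; push_cast; ring_nf
    have h3 : 1 + C * h ≤ Real.exp (C * h) := by linarith [Real.add_one_le_exp (C * h)]
    have h4 : 0 ≤ C * h := by positivity
    rw [h2, ← mul_assoc]
    have h5 : (1 + |a|) * (1 + C * h)
        ≤ ((1 + |x₀|) * Real.exp (C * (h * j))) * Real.exp (C * h) :=
      mul_le_mul (by linarith) h3 (by linarith) (by positivity)
    linarith

/-- If `f` stays within `ε` of `q` along the iterates from `i` to `j`, then over this stretch the
scheme moves with average speed within `ε` of `q`. -/
theorem abs_eulerIter_sub_le {f : ℝ → ℝ} {h x₀ q ε : ℝ} (hh : 0 ≤ h) {i j : ℕ} (hij : i ≤ j)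
    (H : ∀ l, i ≤ l → l < j → |f (eulerIter f h x₀ l) - q| ≤ ε) :
    |eulerIter f h x₀ j - eulerIter f h x₀ i - h * ((j : ℝ) - i) * q|
      ≤ h * ((j : ℝ) - i) * ε := by
  induction j, hij using Nat.le_induction with
  | base => simp
  | succ j hij ih =>
    have h1 := ih fun l hl hlj => H l hl (hlj.trans (Nat.lt_succ_self j))
    have h2 := H j hij (Nat.lt_succ_self j)
    rw [eulerIter_succ]
    push_cast
    have : eulerIter f h x₀ j + h * f (eulerIter f h x₀ j) - eulerIter f h x₀ i
        - h * ((j : ℝ) + 1 - i) * q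
        = (eulerIter f h x₀ j - eulerIter f h x₀ i - h * ((j : ℝ) - i) * q)
          + h * (f (eulerIter f h x₀ j) - q) := by ring
    rw [this]
    refine (abs_add_le _ _).trans ?_
    rw [abs_mul, abs_of_nonneg hh]
    have := mul_le_mul_of_nonneg_left h2 hh
    linarith

/-- A global form of Peano's existence theorem for autonomous scalar equations. The solution is the
pointwise limit of Euler step functions along a nonprincipal ultrafilter; the estimate
`abs_eulerIter_sub_le` passes to the limit and yields the derivative, so that no compactness
in a function space is needed. -/
theorem exists_hasDerivWithinAt_of_continuous {f : ℝ → ℝ} (hf : Continuous f) {C : ℝ}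
    (hC : ∀ x, |f x| ≤ C * (1 + |x|)) (x₀ : ℝ) :
    ∃ k : ℝ → ℝ, k 0 = x₀ ∧ ∀ t, 0 ≤ t → HasDerivWithinAt k (f (k t)) (Ici 0) t := by
  have hC0 : 0 ≤ C := by
    have := (abs_nonneg _).trans (hC 0)
    simpa using this
  let h : ℕ → ℝ := fun n => 1 / ((n : ℝ) + 1)
  have hh : ∀ n, 0 < h n := fun n => by positivity
  let idx : ℕ → ℝ → ℕ := fun n t => ⌊t * ((n : ℝ) + 1)⌋₊
  let K : ℕ → ℝ → ℝ := fun n t => eulerIter f (h n) x₀ (idx n t)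
  let R : ℝ → ℝ := fun T => (1 + |x₀|) * Real.exp (C * T)
  have hhi : ∀ n t, 0 ≤ t → h n * idx n t ≤ t := by
    intro n t ht
    have : (idx n t : ℝ) ≤ t * ((n : ℝ) + 1) := Nat.floor_le (by positivity)
    have h2 : (0 : ℝ) < (n : ℝ) + 1 := by positivity
    simp only [h]
    rw [one_div, inv_mul_le_iff₀ h2]
    linarith
  have hR : ∀ n T (j : ℕ), h n * j ≤ T → |eulerIter f (h n) x₀ j| ≤ R T := by
    intro n T j hj
    have h1 := abs_eulerIter_le (x₀ := x₀) hC0 (hh n).le hC j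
    have h2 : Real.exp (C * (h n * j)) ≤ Real.exp (C * T) :=
      Real.exp_le_exp.2 (mul_le_mul_of_nonneg_left hj hC0)
    have h3 : (1 + |x₀|) * Real.exp (C * (h n * j)) ≤ R T :=
      mul_le_mul_of_nonneg_left h2 (by positivity)
    linarith
  let φ : Ultrafilter ℕ := hyperfilter ℕ
  have hφ : (φ : Filter ℕ) ≤ atTop := by
    rw [← Nat.cofinite_eq_atTop]; exact hyperfilter_le_cofinite
  have hlim : ∀ t, ∃ x, 0 ≤ t → Tendsto (fun n => K n t) φ (𝓝 x) := by
    intro t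
    by_cases ht : 0 ≤ t
    · have hc : IsCompact (Icc (-R t) (R t)) := isCompact_Icc
      obtain ⟨x, -, hx⟩ := hc.ultrafilter_le_nhds' (φ.map fun n => K n t)
        (by
          rw [Ultrafilter.mem_map]
          exact Filter.univ_mem' fun n => abs_le.1 (hR n t _ (hhi n t ht)))
      exact ⟨x, fun _ => hx⟩
    · exact ⟨0, fun h => absurd h ht⟩
  choose k hk using hlim
  have hhlim : Tendsto h φ (𝓝 0) := tendsto_one_div_add_atTop_nhds_zero_nat.mono_left hφ
  have hidx : ∀ t, 0 ≤ t → Tendsto (fun n => h n * idx n t) φ (𝓝 t) := by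
    intro t ht
    have h1 := (tendsto_nat_floor_mul_div_atTop ht (R := ℝ)).comp
      (tendsto_natCast_atTop_atTop.comp (tendsto_add_atTop_nat 1) : Tendsto
        (fun n : ℕ => ((n + 1 : ℕ) : ℝ)) atTop atTop)
    refine (h1.mono_left hφ).congr fun n => ?_
    simp only [Function.comp, h, idx]
    push_cast
    ring
  refine ⟨k, ?_, ?_⟩
  · refine tendsto_nhds_unique (hk 0 le_rfl) ?_
    simp [K, idx, eulerIter]
  · intro t ht
    rw [hasDerivWithinAt_iff_isLittleO, Asymptotics.isLittleO_iff]
    intro ε hε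
    obtain ⟨η, hη, hfη⟩ := Metric.continuousAt_iff.1 (hf.continuousAt (x := k t)) ε hε
    let M : ℝ := C * (1 + R (t + 1))
    have hRt : 0 ≤ R (t + 1) := by positivity
    have hM : 0 ≤ M := by positivity
    have hMf : ∀ n (j : ℕ), h n * j ≤ t + 1 → |f (eulerIter f (h n) x₀ j) - 0| ≤ M := by
      intro n j hj
      rw [sub_zero]
      exact (hC _).trans (mul_le_mul_of_nonneg_left (by linarith [hR n _ j hj]) hC0)
    obtain ⟨δ, hδ, hδ1, hδη⟩ : ∃ δ : ℝ, 0 < δ ∧ δ ≤ 1 ∧ M * δ < η / 2 := by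
      refine ⟨min 1 (η / (4 * (M + 1))), by positivity, min_le_left _ _, ?_⟩
      have : M * min 1 (η / (4 * (M + 1))) ≤ M * (η / (4 * (M + 1))) :=
        mul_le_mul_of_nonneg_left (min_le_right _ _) hM
      refine this.trans_lt ?_
      rw [mul_div_assoc', div_lt_div_iff₀ (by positivity) (by norm_num)]
      nlinarith
    -- the discrete estimate between two indices near `t`, in either order
    have key : ∀ n (i j l₀ : ℕ), i ≤ j → i ≤ l₀ → l₀ ≤ j → h n * j ≤ t + 1 →
        |eulerIter f (h n) x₀ l₀ - k t| < η / 2 → M * (h n * ((j : ℝ) - i)) < η / 2 →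
        |eulerIter f (h n) x₀ j - eulerIter f (h n) x₀ i - h n * ((j : ℝ) - i) * f (k t)|
          ≤ h n * ((j : ℝ) - i) * ε := by
      intro n i j l₀ hij hil hlj hj hl₀ hMη
      refine abs_eulerIter_sub_le (hh n).le hij fun l hl hl' => ?_
      have hmono : ∀ a b : ℕ, a ≤ b → b ≤ j → i ≤ a →
          |eulerIter f (h n) x₀ b - eulerIter f (h n) x₀ a| < η / 2 := by
        intro a b hab hbj hia
        have h1 := abs_eulerIter_sub_le (f := f) (x₀ := x₀) (q := 0) (ε := M) (hh n).le hab
          fun l _ hl => hMf n l (le_trans (mul_le_mul_of_nonneg_left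
            (by exact_mod_cast (hl.le.trans hbj)) (hh n).le) hj)
        rw [mul_zero, sub_zero] at h1
        refine h1.trans_lt (lt_of_le_of_lt ?_ hMη)
        have hb : (b : ℝ) ≤ j := by exact_mod_cast hbj
        have ha : (i : ℝ) ≤ a := by exact_mod_cast hia
        have : h n * ((b : ℝ) - a) ≤ h n * ((j : ℝ) - i) :=
          mul_le_mul_of_nonneg_left (by linarith) (hh n).le
        calc h n * ((b : ℝ) - a) * M ≤ h n * ((j : ℝ) - i) * M :=
              mul_le_mul_of_nonneg_right this hM
          _ = _ := by ring
      have hd : |eulerIter f (h n) x₀ l - eulerIter f (h n) x₀ l₀| < η / 2 := by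
        rcases le_total l l₀ with hll | hll
        · rw [abs_sub_comm]; exact hmono l l₀ hll hlj hl
        · exact hmono l₀ l hll hl'.le hil
      have : dist (eulerIter f (h n) x₀ l) (k t) < η := by
        rw [Real.dist_eq]
        refine (abs_sub_le _ (eulerIter f (h n) x₀ l₀) _).trans_lt ?_
        linarith
      exact (hfη this).le
    have hs0 : Ioo (t - δ) (t + δ) ∩ Ici 0 ∈ 𝓝[Ici 0] t :=
      inter_mem (mem_nhdsWithin_of_mem_nhds (Ioo_mem_nhds (by linarith) (by linarith)))
        self_mem_nhdsWithin
    filter_upwards [hs0] with s hs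
    obtain ⟨⟨hs1, hs2⟩, hs3⟩ := hs
    have hs3 : 0 ≤ s := hs3
    have hlimd : Tendsto (fun n => h n * idx n s - h n * idx n t) φ (𝓝 (s - t)) :=
      (hidx s hs3).sub (hidx t ht)
    have hsmall : ∀ᶠ n in (φ : Filter ℕ), |K n t - k t| < η / 2 := by
      have := (hk t ht).eventually (Metric.ball_mem_nhds _ (half_pos hη))
      simpa [Real.dist_eq] using this
    have hsmall2 : ∀ᶠ n in (φ : Filter ℕ), M * |h n * idx n s - h n * idx n t| < η / 2 := by
      have h1 : Tendsto (fun n => M * |h n * idx n s - h n * idx n t|) φ (𝓝 (M * |s - t|)) :=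
        (hlimd.abs).const_mul M
      refine h1.eventually (gt_mem_nhds ?_)
      refine lt_of_le_of_lt (mul_le_mul_of_nonneg_left ?_ hM) hδη
      exact (abs_lt.2 ⟨by linarith, by linarith⟩).le
    have hlim2 : Tendsto (fun n => K n s - K n t - (h n * idx n s - h n * idx n t) * f (k t)) φ
        (𝓝 (k s - k t - (s - t) * f (k t))) :=
      ((hk s hs3).sub (hk t ht)).sub (hlimd.mul_const _)
    have hfin : |k s - k t - (s - t) * f (k t)| ≤ |s - t| * ε := by
      refine le_of_tendsto_of_tendsto hlim2.abs (hlimd.abs.mul_const ε) ?_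
      filter_upwards [hsmall, hsmall2] with n hn hn2
      rcases le_total t s with hts | hts
      · have hle : idx n t ≤ idx n s := Nat.floor_mono (by gcongr)
        have hle' : (idx n t : ℝ) ≤ idx n s := by exact_mod_cast hle
        have hab : |h n * idx n s - h n * idx n t| = h n * ((idx n s : ℝ) - idx n t) := by
          rw [← mul_sub, abs_of_nonneg (mul_nonneg (hh n).le (by linarith))]
        have := key n (idx n t) (idx n s) (idx n t) hle le_rfl hle
          ((hhi n s hs3).trans (by linarith)) hn (by rw [← hab]; exact hn2)
        rw [hab]
        simpa only [K, mul_sub] using this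
      · have hle : idx n s ≤ idx n t := Nat.floor_mono (by gcongr)
        have hle' : (idx n s : ℝ) ≤ idx n t := by exact_mod_cast hle
        have hab : |h n * idx n s - h n * idx n t| = h n * ((idx n t : ℝ) - idx n s) := by
          rw [abs_sub_comm, ← mul_sub, abs_of_nonneg (mul_nonneg (hh n).le (by linarith))]
        have := key n (idx n s) (idx n t) (idx n t) hle hle le_rfl
          ((hhi n t ht).trans (by linarith)) hn (by rw [← hab]; exact hn2)
        rw [hab, abs_sub_comm]
        refine le_trans (le_of_eq ?_) this
        rw [abs_sub_comm, ← abs_neg]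
        congr 1
        simp only [K]
        ring
    simp only [Real.norm_eq_abs, smul_eq_mul]
    rw [mul_comm ε]
    exact hfin

/-- A path that does not decrease while below the level `m` never falls below `m`. -/
theorem le_of_hasDerivAt_nonneg_of_lt {k : ℝ → ℝ} {m : ℝ} (hc : ContinuousOn k (Ici 0))
    (h0 : m ≤ k 0) (hd : ∀ t, 0 < t → k t < m → ∃ d, 0 ≤ d ∧ HasDerivAt k d t) :
    ∀ t, 0 ≤ t → m ≤ k t := by
  intro t₁ ht₁
  by_contra hlt
  push Not at hlt
  have hcI : ContinuousOn k (Icc 0 t₁) := hc.mono Icc_subset_Ici_self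
  have hS : IsCompact (Icc 0 t₁ ∩ k ⁻¹' Ici m) :=
    (isCompact_Icc).of_isClosed_subset (hcI.preimage_isClosed_of_isClosed isClosed_Icc isClosed_Ici)
      inter_subset_left
  obtain ⟨s, ⟨hs, hsm⟩, hmax⟩ := hS.exists_isGreatest ⟨0, ⟨le_rfl, ht₁⟩, h0⟩
  have hlt' : ∀ x ∈ Ioo s t₁, k x < m := by
    intro x hx
    by_contra hge
    have := hmax (⟨⟨hs.1.trans hx.1.le, hx.2.le⟩, not_lt.1 hge⟩ : x ∈ Icc 0 t₁ ∩ k ⁻¹' Ici m)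
    exact absurd this (not_le.2 hx.1)
  have hmono : MonotoneOn k (Icc s t₁) := by
    refine monotoneOn_of_deriv_nonneg (convex_Icc _ _)
      (hcI.mono (Icc_subset_Icc_left hs.1)) ?_ ?_ <;> rw [interior_Icc] <;> intro x hx
    · obtain ⟨d, -, hd⟩ := hd x (hs.1.trans_lt hx.1) (hlt' x hx)
      exact hd.differentiableAt.differentiableWithinAt
    · obtain ⟨d, hd0, hd⟩ := hd x (hs.1.trans_lt hx.1) (hlt' x hx)
      rw [hd.deriv]; exact hd0
  have := hmono (left_mem_Icc.2 hs.2) (right_mem_Icc.2 hs.2) hs.2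
  have hsm : m ≤ k s := hsm
  linarith

theorem locallyAC_of_hasDerivWithinAt {k h : ℝ → ℝ} (hc : ContinuousOn h (Ici 0))
    (hk : ∀ t, 0 ≤ t → HasDerivWithinAt k (h t) (Ici 0) t) : LocallyAC k := by
  intro T hT
  obtain ⟨M, hM⟩ := isCompact_Icc.exists_bound_of_continuousOn
    (hc.mono (Icc_subset_Ici_self : Icc 0 T ⊆ Ici 0))
  refine LipschitzOnWith.absolutelyContinuousOnInterval (K := M.toNNReal) ?_
  rw [uIcc_of_le hT]
  refine (convex_Icc 0 T).lipschitzOnWith_of_nnnorm_hasDerivWithin_le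
    (fun x hx => (hk x hx.1).mono Icc_subset_Ici_self) fun x hx => ?_
  rw [← NNReal.coe_le_coe, coe_nnnorm]
  exact (hM x hx).trans (Real.le_coe_toNNReal M)

/-- An equation on `(0, ∞)` whose right-hand side is positive near `0` and grows at most linearly
has a global positive solution from every positive initial value. -/
theorem exists_positive_solution {f : ℝ → ℝ} (hf : ContinuousOn f (Ioi 0)) {δ : ℝ} (hδ : 0 < δ)
    (hpos : ∀ x ∈ Ioo 0 δ, 0 < f x) {C : ℝ} (hC : ∀ x, 0 < x → f x ≤ C * (1 + x))
    {x₀ : ℝ} (hx₀ : 0 < x₀) :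
    ∃ k : ℝ → ℝ, k 0 = x₀ ∧ (∀ t, 0 ≤ t → 0 < k t) ∧ LocallyAC k ∧
      ∀ t, 0 < t → HasDerivAt k (f (k t)) t := by
  -- it suffices to solve a modified equation and to see that the solution does not notice
  suffices H : ∃ k : ℝ → ℝ, k 0 = x₀ ∧ (∀ t, 0 ≤ t → 0 < k t) ∧
      ∀ t, 0 ≤ t → HasDerivWithinAt k (f (k t)) (Ici 0) t by
    obtain ⟨k, h0, hp, hd⟩ := H
    refine ⟨k, h0, hp, locallyAC_of_hasDerivWithinAt (h := fun t => f (k t)) ?_ hd,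
      fun t ht => (hd t ht.le).hasDerivAt (Ici_mem_nhds ht)⟩
    exact hf.comp (fun t ht => (hd t ht).continuousWithinAt) fun t ht => hp t ht
  by_cases hfx : f x₀ ≤ 0
  · have hδx : δ ≤ x₀ := by
      by_contra hlt
      exact absurd (hpos x₀ ⟨hx₀, not_le.1 hlt⟩) (not_lt.2 hfx)
    set m := δ / 2 with hm
    have hm0 : 0 < m := by positivity
    have hmx : m ≤ x₀ := by linarith
    have hfm : 0 < f m := hpos m ⟨hm0, by linarith⟩
    let clip : ℝ → ℝ := fun x => min (max x m) x₀
    have hclip : ∀ x, clip x ∈ Icc m x₀ := fun x =>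
      ⟨le_min (le_max_right _ _) hmx, min_le_right _ _⟩
    have hg : Continuous fun x => f (clip x) :=
      hf.comp_continuous (by fun_prop) fun x => hm0.trans_le (hclip x).1
    obtain ⟨M, hM⟩ := isCompact_Icc.exists_bound_of_continuousOn
      (hf.mono fun x (hx : x ∈ Icc m x₀) => hm0.trans_le hx.1)
    have hM0 : 0 ≤ M := (norm_nonneg _).trans (hM m ⟨le_rfl, hmx⟩)
    obtain ⟨k, h0, hd⟩ := exists_hasDerivWithinAt_of_continuous hg (C := M) (fun x =>
      (hM _ (hclip x)).trans (le_mul_of_one_le_right hM0 (by linarith [abs_nonneg x]))) x₀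
    have hcont : ContinuousOn k (Ici 0) := fun t ht => (hd t ht).continuousWithinAt
    have hda : ∀ t, 0 < t → HasDerivAt k (f (clip (k t))) t := fun t ht =>
      (hd t ht.le).hasDerivAt (Ici_mem_nhds ht)
    have hlow : ∀ t, 0 ≤ t → m ≤ k t :=
      le_of_hasDerivAt_nonneg_of_lt hcont (h0 ▸ hmx) fun t ht hlt => by
        refine ⟨_, ?_, hda t ht⟩
        have : clip (k t) = m := by simp [clip, max_eq_right hlt.le, min_eq_left hmx]
        rw [this]; exact hfm.le
    have hup : ∀ t, 0 ≤ t → -x₀ ≤ -k t :=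
      le_of_hasDerivAt_nonneg_of_lt hcont.neg (by rw [h0]) fun t ht hlt => by
        refine ⟨_, ?_, (hda t ht).neg⟩
        have : clip (k t) = x₀ := by
          simp only [clip]; exact min_eq_right (le_max_of_le_left (by linarith))
        rw [this]; linarith
    refine ⟨k, h0, fun t ht => hm0.trans_le (hlow t ht), fun t ht => ?_⟩
    have : clip (k t) = k t := by
      simp only [clip]
      rw [max_eq_left (hlow t ht), min_eq_left (by linarith [hup t ht])]
    simpa [this] using hd t ht
  · push Not at hfx
    have hg : Continuous fun x => max (f (max x x₀)) 0 :=
      (hf.comp_continuous (by fun_prop) fun x => hx₀.trans_le (le_max_right _ _)).max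
        continuous_const
    have hgb : ∀ x, |max (f (max x x₀)) 0| ≤ (|C| * (1 + x₀)) * (1 + |x|) := by
      intro x
      rw [abs_of_nonneg (le_max_right _ _)]
      refine max_le ((hC _ (hx₀.trans_le (le_max_right _ _))).trans ?_) (by positivity)
      have h1 : max x x₀ ≤ |x| + x₀ :=
        max_le (by linarith [le_abs_self x]) (by linarith [abs_nonneg x])
      have h2 : 0 < max x x₀ := hx₀.trans_le (le_max_right _ _)
      calc C * (1 + max x x₀) ≤ |C| * (1 + max x x₀) :=
            mul_le_mul_of_nonneg_right (le_abs_self C) (by linarith)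
        _ ≤ |C| * ((1 + x₀) * (1 + |x|)) := by
            refine mul_le_mul_of_nonneg_left ?_ (abs_nonneg C)
            nlinarith [mul_nonneg hx₀.le (abs_nonneg x)]
        _ = _ := by ring
    obtain ⟨k, h0, hd⟩ := exists_hasDerivWithinAt_of_continuous hg hgb x₀
    have hcont : ContinuousOn k (Ici 0) := fun t ht => (hd t ht).continuousWithinAt
    have hda : ∀ t, 0 < t → HasDerivAt k (max (f (max (k t) x₀)) 0) t := fun t ht =>
      (hd t ht.le).hasDerivAt (Ici_mem_nhds ht)
    have hlow : ∀ t, 0 ≤ t → x₀ ≤ k t :=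
      le_of_hasDerivAt_nonneg_of_lt hcont h0.ge fun t ht _ => ⟨_, le_max_right _ _, hda t ht⟩
    have hfk : ContinuousOn (fun t => f (k t)) (Ici 0) :=
      hf.comp hcont fun t ht => hx₀.trans_le (hlow t ht)
    -- the solution is stationary wherever `f` is negative, hence never gets there
    have hnn : ∀ t, 0 ≤ t → 0 ≤ f (k t) := by
      intro t₁ ht₁
      by_contra hlt
      push Not at hlt
      have hS : IsCompact (Icc 0 t₁ ∩ (fun t => f (k t)) ⁻¹' Ici 0) :=
        isCompact_Icc.of_isClosed_subset
          ((hfk.mono Icc_subset_Ici_self).preimage_isClosed_of_isClosed isClosed_Icc isClosed_Ici)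
          inter_subset_left
      obtain ⟨s, ⟨hs, hsm⟩, hmax⟩ := hS.exists_isGreatest
        ⟨0, ⟨le_rfl, ht₁⟩, by simpa [h0] using hfx.le⟩
      have hsm : 0 ≤ f (k s) := hsm
      have hz : ∀ x ∈ Ioo s t₁, HasDerivAt k 0 x := by
        intro x hx
        have hx0 : 0 < x := hs.1.trans_lt hx.1
        have hneg : f (k x) < 0 := by
          by_contra hge
          exact absurd (hmax (⟨⟨hx0.le, hx.2.le⟩, not_lt.1 hge⟩ :
            x ∈ Icc 0 t₁ ∩ (fun t => f (k t)) ⁻¹' Ici 0)) (not_le.2 hx.1)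
        have := hda x hx0
        rwa [max_eq_left (hlow x hx0.le), max_eq_right hneg.le] at this
      have hst : s < t₁ := by
        refine lt_of_le_of_ne hs.2 fun h => ?_
        rw [h] at hsm; linarith
      have hcI : ContinuousOn k (Icc s t₁) :=
        hcont.mono (Icc_subset_Ici_self.trans (Ici_subset_Ici.2 hs.1))
      obtain ⟨ξ, -, hξ⟩ := exists_hasDerivAt_eq_slope k (fun _ => 0) hst hcI hz
      have : k t₁ = k s := by
        rw [eq_comm, div_eq_zero_iff] at hξ
        rcases hξ with h | h <;> linarith
      rw [this] at hlt; linarith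
    refine ⟨k, h0, fun t ht => hx₀.trans_le (hlow t ht), fun t ht => ?_⟩
    have := hd t ht
    rwa [max_eq_left (hlow t ht), max_eq_left (hnn t ht)] at this

/-- An absolutely continuous solution of an equation with continuous right-hand side is a
classical solution. -/
theorem hasDerivAt_of_locallyAC {f k : ℝ → ℝ} (hf : ContinuousOn f (Ioi 0))
    (hk : LocallyAC k) (hpos : ∀ t, 0 ≤ t → 0 < k t)
    (hd : ∀ᵐ t ∂(volume.restrict (Ici 0)), HasDerivAt k (f (k t)) t) :
    ContinuousOn k (Ici 0) ∧ ∀ t, 0 < t → HasDerivAt k (f (k t)) t := by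
  have hcont : ContinuousOn k (Ici 0) := by
    intro t ht
    have ht : (0 : ℝ) ≤ t := ht
    have h1 := (hk (t + 1) (by linarith)).continuousOn
    rw [uIcc_of_le (by linarith)] at h1
    refine (h1 t ⟨ht, by linarith⟩).mono_of_mem_nhdsWithin ?_
    rw [← Ici_inter_Iic, inter_comm]
    exact inter_mem (mem_nhdsWithin_of_mem_nhds (Iic_mem_nhds (by linarith))) self_mem_nhdsWithin
  refine ⟨hcont, fun t ht => ?_⟩
  have hfk : ContinuousOn (fun t => f (k t)) (Ici 0) := hf.comp hcont fun t ht => hpos t ht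
  have hint : ∀ T, 0 ≤ T → k T = k 0 + ∫ s in 0..T, f (k s) := by
    intro T hT
    have h1 := (hk T hT).integral_deriv_eq_sub
    have h2 : ∫ s in 0..T, deriv k s = ∫ s in 0..T, f (k s) := by
      refine intervalIntegral.integral_congr_ae ?_
      rw [ae_restrict_iff' measurableSet_Ici] at hd
      filter_upwards [hd] with s hs hsT
      rw [uIoc_of_le hT] at hsT
      exact (hs hsT.1.le).deriv
    linarith
  have hFTC : HasDerivAt (fun T => ∫ s in 0..T, f (k s)) (f (k t)) t := by
    refine intervalIntegral.integral_hasDerivAt_right ?_ ?_ ?_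
    · refine (hfk.mono ?_).intervalIntegrable
      rw [uIcc_of_le ht.le]; exact Icc_subset_Ici_self
    · exact (hfk.mono Ioi_subset_Ici_self).stronglyMeasurableAtFilter isOpen_Ioi t ht
    · exact hfk.continuousAt (Ici_mem_nhds ht)
  refine (hFTC.const_add (k 0)).congr_of_eventuallyEq ?_
  filter_upwards [Ioi_mem_nhds ht] with s hs
  exact hint s (le_of_lt hs)

/-! ### Superdifferentials of increasing concave functions -/

section Superdiff

variable {V : ℝ → ℝ}

theorem superdiff_nonempty (hV : ConcaveOn ℝ (Ioi 0) V) {k : ℝ} (hk : 0 < k) :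
    (superdiff V k).Nonempty := by
  -- the left derivative, as the infimum of the slopes to the left
  set S : Set ℝ := (fun y => (V k - V y) / (k - y)) '' Ioo 0 k with hS
  have hlow : ∀ z, k < z → ∀ s ∈ S, (V z - V k) / (z - k) ≤ s := by
    rintro z hz _ ⟨y, hy, rfl⟩
    exact hV.slope_anti_adjacent (mem_Ioi.2 hy.1) (mem_Ioi.2 (hk.trans hz)) hy.2 hz
  have hne : S.Nonempty := (nonempty_Ioo.2 hk).image _
  have hbdd : BddBelow S := ⟨_, fun s hs => hlow (k + 1) (by linarith) s hs⟩
  refine ⟨sInf S, fun y hy => ?_⟩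
  rcases lt_trichotomy y k with hyk | rfl | hyk
  · have h1 : sInf S ≤ (V k - V y) / (k - y) := csInf_le hbdd ⟨y, ⟨hy, hyk⟩, rfl⟩
    rw [le_div_iff₀ (by linarith)] at h1
    linarith
  · simp
  · have h1 : (V y - V k) / (y - k) ≤ sInf S := le_csInf hne (hlow y hyk)
    rwa [div_le_iff₀ (by linarith)] at h1

theorem superdiff_pos (hV : StrictMonoOn V (Ioi 0)) {k p : ℝ} (hk : 0 < k)
    (hp : p ∈ superdiff V k) : 0 < p := by
  have h1 := hp (k + 1) (by linarith)
  have h2 := hV (mem_Ioi.2 hk) (mem_Ioi.2 (by linarith : 0 < k + 1)) (by linarith)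
  linarith

theorem superdiff_antitone {k l p q : ℝ} (hk : 0 < k) (hkl : k < l)
    (hp : p ∈ superdiff V k) (hq : q ∈ superdiff V l) : q ≤ p := by
  have h1 := hp l (hk.trans hkl)
  have h2 := hq k hk
  have : (q - p) * (l - k) ≤ 0 := by linarith
  by_contra h
  push Not at h
  nlinarith [mul_pos (sub_pos.2 h) (sub_pos.2 hkl)]

theorem superdiff_ordConnected {k p q r : ℝ} (hp : p ∈ superdiff V k) (hq : q ∈ superdiff V k)
    (hpr : p ≤ r) (hrq : r ≤ q) : r ∈ superdiff V k := by
  intro y hy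
  rcases le_total y k with h | h
  · refine (hq y hy).trans ?_
    nlinarith
  · refine (hp y hy).trans ?_
    nlinarith

/-- The superdifferential has closed graph and is locally bounded. -/
theorem exists_subseq_superdiff (hm : StrictMonoOn V (Ioi 0)) (hc : ContinuousOn V (Ioi 0))
    {k : ℝ} (hk : 0 < k) {x p : ℕ → ℝ} (hx : Tendsto x atTop (𝓝 k))
    (hp : ∀ n, p n ∈ superdiff V (x n)) :
    ∃ q ∈ superdiff V k, ∃ φ : ℕ → ℕ, StrictMono φ ∧ Tendsto (p ∘ φ) atTop (𝓝 q) := by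
  have hev : ∀ᶠ n in atTop, p n ∈ Icc 0 (4 * (V (2 * k) - V (k / 4)) / k) := by
    filter_upwards [hx (Ioo_mem_nhds (by linarith : k / 2 < k) (by linarith : k < 2 * k))]
      with n hn
    have hn : x n ∈ Ioo (k / 2) (2 * k) := hn
    have hx0 : 0 < x n := by linarith [hn.1]
    have hp0 := superdiff_pos hm hx0 (hp n)
    refine ⟨hp0.le, ?_⟩
    have h1 := hp n (k / 4) (by linarith)
    have h2 := hm (mem_Ioi.2 hx0) (mem_Ioi.2 (by linarith : 0 < 2 * k)) hn.2
    rw [le_div_iff₀ hk]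
    nlinarith [hn.1, mul_pos hp0 (by linarith [hn.1] : 0 < x n - k / 2)]
  obtain ⟨q, -, φ, hφ, hq⟩ := isCompact_Icc.tendsto_subseq' hev.frequently
  refine ⟨q, fun y hy => ?_, φ, hφ, hq⟩
  have hxφ := hx.comp hφ.tendsto_atTop
  have hV : Tendsto (fun n => V (x (φ n))) atTop (𝓝 (V k)) :=
    (hc.continuousAt (Ioi_mem_nhds hk)).tendsto.comp hxφ
  exact le_of_tendsto_of_tendsto' (tendsto_const_nhds.sub hV) (hq.mul (tendsto_const_nhds.sub hxφ))
    fun n => hp (φ n) y hy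

/-- An element of the superdifferential at `δ` is a Lipschitz constant to the right of `δ`. -/
theorem abs_sub_le_of_superdiff (hc : ConcaveOn ℝ (Ioi 0) V) (hm : StrictMonoOn V (Ioi 0))
    {δ : ℝ} (hδ : 0 < δ) {p : ℝ} (hp : p ∈ superdiff V δ) {x y : ℝ} (hx : δ < x) (hy : δ < y) :
    |V x - V y| ≤ p * |x - y| := by
  wlog hxy : x ≤ y generalizing x y
  · rw [abs_sub_comm, abs_sub_comm x]
    exact this hy hx (le_of_not_ge hxy)
  have hx0 := hδ.trans hx
  obtain ⟨q, hq⟩ := superdiff_nonempty hc hx0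
  have hqp : q ≤ p := superdiff_antitone hδ hx hp hq
  have h1 := hq y (hδ.trans hy)
  have h2 := hm.monotoneOn (mem_Ioi.2 hx0) (mem_Ioi.2 (hδ.trans hy)) hxy
  rw [abs_sub_comm, abs_of_nonneg (by linarith), abs_sub_comm, abs_of_nonneg (by linarith)]
  nlinarith

end Superdiff

/-! ### The Hamilton–Jacobi–Bellman equation on the superdifferential -/

variable {ρ : ℝ} {W : Set (ℝ → ℝ)} {u : ℝ → ℝ → EReal} {F : ℝ → ℝ → ℝ} {V : ℝ → ℝ}

theorem le_hamiltonian (u : ℝ → ℝ → EReal) (F : ℝ → ℝ → ℝ) (p k : ℝ) {c : ℝ} (hc : 0 ≤ c) :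
    ((F k c * p : ℝ) : EReal) + u c k ≤ hamiltonian u F p k :=
  le_iSup₂ (f := fun (c : ℝ) (_ : 0 ≤ c) => ((F k c * p : ℝ) : EReal) + u c k) c hc

theorem hamiltonian_le_of_tendsto (hu : UtilityAssumption u) (hF : TechnologyAssumption W F)
    {k p h : ℝ} (hk : 0 ≤ k) {x q g : ℕ → ℝ} (hx0 : ∀ n, 0 ≤ x n) (hx : Tendsto x atTop (𝓝 k))
    (hq : Tendsto q atTop (𝓝 p)) (hg : Tendsto g atTop (𝓝 h))
    (H : ∀ n, hamiltonian u F (q n) (x n) ≤ (g n : EReal)) : hamiltonian u F p k ≤ (h : EReal) := by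
  refine iSup₂_le fun c hc => ?_
  have hFt : Tendsto (fun n => F (x n) c) atTop (𝓝 (F k c)) := by
    have h1 : Tendsto (fun n => (x n, c)) atTop (𝓝[quadrant] (k, c)) :=
      tendsto_nhdsWithin_iff.2 ⟨hx.prodMk_nhds tendsto_const_nhds,
        Eventually.of_forall fun n => ⟨hx0 n, hc⟩⟩
    exact (hF.continuousOn (k, c) ⟨hk, hc⟩).tendsto.comp h1
  have hut : Tendsto (fun n => u c (x n)) atTop (𝓝 (u c k)) := by
    have h1 : Tendsto (fun n => (c, x n)) atTop (𝓝[quadrant] (c, k)) :=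
      tendsto_nhdsWithin_iff.2 ⟨tendsto_const_nhds.prodMk_nhds hx,
        Eventually.of_forall fun n => ⟨hc, hx0 n⟩⟩
    exact (hu.continuousOn (c, k) ⟨hc, hk⟩).tendsto.comp h1
  have hadd := (EReal.continuousAt_add (p := (((F k c * p : ℝ) : EReal), u c k))
    (Or.inl (EReal.coe_ne_top _)) (Or.inl (EReal.coe_ne_bot _))).tendsto.comp
    ((EReal.tendsto_coe.2 (hFt.mul hq)).prodMk_nhds hut)
  refine le_of_tendsto_of_tendsto' hadd (EReal.tendsto_coe.2 hg) fun n => ?_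
  exact (le_hamiltonian u F (q n) (x n) hc).trans (H n)

/-- Sublevel sets of the Hamiltonian in the costate are convex. -/
theorem hamiltonian_le_of_mem_Icc {k p q r : ℝ} {h : EReal} (hp : hamiltonian u F p k ≤ h)
    (hq : hamiltonian u F q k ≤ h) (hpr : p ≤ r) (hrq : r ≤ q) : hamiltonian u F r k ≤ h := by
  refine iSup₂_le fun c hc => ?_
  rcases le_total 0 (F k c) with hs | hs
  · refine le_trans ?_ ((le_hamiltonian u F q k hc).trans hq)
    gcongr
  · refine le_trans ?_ ((le_hamiltonian u F p k hc).trans hp)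
    have : F k c * r ≤ F k c * p := mul_le_mul_of_nonpos_left hpr hs
    gcongr

/-- Every interval contains a point at which `V` is touched from below by a parabola; there the
subsolution inequality holds on the superdifferential, which is a single point. -/
theorem exists_hamiltonian_le (hc : ConcaveOn ℝ (Ioi 0) V) (hsol : IsViscositySolution ρ u F V)
    {a b : ℝ} (ha : 0 < a) (hab : a < b) :
    ∃ x ∈ Ioo a b, ∃ p ∈ superdiff V x, hamiltonian u F p x ≤ ((ρ * V x : ℝ) : EReal) := by
  set m := (a + b) / 2 with hm
  set r := (b - a) / 2 with hr
  have hr0 : 0 < r := by rw [hr]; linarith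
  have hsub : Icc a b ⊆ Ioi 0 := fun x hx => ha.trans_le hx.1
  obtain ⟨N, hN⟩ : ∃ N : ℝ, |V m - V a| + |V m - V b| < N * r ^ 2 :=
    ⟨(|V m - V a| + |V m - V b| + 1) / r ^ 2, by
      rw [div_mul_cancel₀ _ (by positivity)]; linarith⟩
  have hcont : ContinuousOn (fun x => V x + N * (x - m) ^ 2) (Icc a b) :=
    (hsol.1.mono hsub).add (by fun_prop)
  obtain ⟨x, hx, hmin⟩ := isCompact_Icc.exists_isMinOn (nonempty_Icc.2 hab.le) hcont
  have hmin' : ∀ y ∈ Icc a b, V x + N * (x - m) ^ 2 ≤ V y + N * (y - m) ^ 2 := fun y hy => hmin hy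
  have hmx := hmin' m ⟨by linarith, by linarith⟩
  have hxa : x ≠ a := by
    rintro rfl
    have : x - m = -r := by rw [hm, hr]; ring
    rw [this] at hmx
    nlinarith [le_abs_self (V m - V x), abs_nonneg (V m - V b)]
  have hxb : x ≠ b := by
    rintro rfl
    have : x - m = r := by rw [hm, hr]; ring
    rw [this] at hmx
    nlinarith [le_abs_self (V m - V x), abs_nonneg (V m - V a)]
  have hxI : x ∈ Ioo a b := ⟨lt_of_le_of_ne hx.1 hxa.symm, lt_of_le_of_ne hx.2 hxb⟩
  have hx0 : 0 < x := ha.trans hxI.1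
  set φ : ℝ → ℝ := fun y => V x + N * (x - m) ^ 2 - N * (y - m) ^ 2 with hφ
  have hφd : HasDerivAt φ (-(N * (2 * (x - m)))) x := by
    have h1 : HasDerivAt (fun y : ℝ => (y - m) ^ 2) (2 * (x - m)) x := by
      simpa using ((hasDerivAt_id x).sub_const m).fun_pow 2
    exact (h1.const_mul N).const_sub _
  have hφV : ∀ y ∈ Ioo a b, φ y ≤ V y := fun y hy => by
    have := hmin' y (Ioo_subset_Icc_self hy)
    simp only [hφ]; linarith
  have hφx : φ x = V x := by simp [hφ]
  obtain ⟨p, hp⟩ := superdiff_nonempty hc hx0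
  refine ⟨x, hxI, p, hp, ?_⟩
  have hH := hsol.2.1.2 x hx0 (Ioo a b) φ isOpen_Ioo hxI (fun y hy => ha.trans hy.1)
    (by
      apply ContDiff.contDiffOn
      simp only [hφ]; fun_prop) hφx hφV
  have hpd : deriv φ x = p := by
    have hloc : IsLocalMax (fun y => φ y - p * (y - x)) x := by
      filter_upwards [Ioo_mem_nhds hxI.1 hxI.2] with y hy
      have h1 := hp y (ha.trans hy.1)
      have h2 := hφV y hy
      simp only [sub_self, mul_zero, sub_zero, hφx]
      linarith
    have h2 : HasDerivAt (fun y => φ y - p * (y - x)) (-(N * (2 * (x - m))) - p * 1) x :=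
      hφd.sub (((hasDerivAt_id x).sub_const x).const_mul p)
    have h3 := hloc.hasDerivAt_eq_zero h2
    rw [hφd.deriv]; linarith
  rwa [hpd] at hH

/-- Intervals shrinking to `k` yield a costate, approximable by superdifferentials at points of
these intervals, for which the subsolution inequality holds at `k`. -/
theorem exists_hamiltonian_le_of_tendsto (hu : UtilityAssumption u)
    (hF : TechnologyAssumption W F) (hV : GrowthClass ρ F V) (hsol : IsViscositySolution ρ u F V)
    {k : ℝ} (hk : 0 < k) {a b : ℕ → ℝ} (ha0 : ∀ n, 0 < a n) (hab : ∀ n, a n < b n)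
    (ha : Tendsto a atTop (𝓝 k)) (hb : Tendsto b atTop (𝓝 k)) :
    ∃ r, hamiltonian u F r k ≤ ((ρ * V k : ℝ) : EReal) ∧ ∃ x q : ℕ → ℝ,
      (∀ n, x n ∈ Ioo (a n) (b n)) ∧ (∀ n, q n ∈ superdiff V (x n)) ∧
      ∃ φ : ℕ → ℕ, Tendsto (q ∘ φ) atTop (𝓝 r) := by
  choose x hx q hq hH using fun n => exists_hamiltonian_le hV.concave hsol (ha0 n) (hab n)
  have hxk : Tendsto x atTop (𝓝 k) :=
    tendsto_of_tendsto_of_tendsto_of_le_of_le ha hb (fun n => (hx n).1.le) fun n => (hx n).2.le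
  obtain ⟨r, -, φ, hφ, hφr⟩ := exists_subseq_superdiff hV.increasing hsol.1 hk hxk hq
  refine ⟨r, ?_, x, q, hx, hq, φ, hφr⟩
  have hxφ := hxk.comp hφ.tendsto_atTop
  refine hamiltonian_le_of_tendsto hu hF hk.le (x := x ∘ φ) (q := q ∘ φ)
    (g := fun n => ρ * V (x (φ n))) (fun n => ((ha0 _).trans (hx _).1).le) hxφ hφr ?_
    fun n => hH (φ n)
  exact ((hsol.1.continuousAt (Ioi_mem_nhds hk)).tendsto.comp hxφ).const_mul ρ

/-- A concave viscosity solution satisfies the Hamilton–Jacobi–Bellman equation with every element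
of its superdifferential: the two extreme elements are limits of superdifferentials at points
touched by parabolas from either side, and the Hamiltonian is convex in the costate. -/
theorem hamiltonian_eq (hu : UtilityAssumption u) (hF : TechnologyAssumption W F)
    (hV : GrowthClass ρ F V) (hsol : IsViscositySolution ρ u F V) {k p : ℝ} (hk : 0 < k)
    (hp : p ∈ superdiff V k) : hamiltonian u F p k = ((ρ * V k : ℝ) : EReal) := by
  refine le_antisymm ?_ ?_
  · have hlim : ∀ z : ℝ, Tendsto (fun n : ℕ => k + z * (1 / ((n : ℝ) + 1))) atTop (𝓝 k) := by
      intro z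
      simpa using (tendsto_one_div_add_atTop_nhds_zero_nat.const_mul z).const_add k
    have hn : ∀ n : ℕ, 0 < 1 / ((n : ℝ) + 1) := fun n => by positivity
    have hn1 : ∀ n : ℕ, 1 / ((n : ℝ) + 1) ≤ 1 := fun n => by
      rw [div_le_one (by positivity)]; linarith [n.cast_nonneg (α := ℝ)]
    obtain ⟨r, hr, x, q, hx, hq, φ, hφ⟩ := exists_hamiltonian_le_of_tendsto hu hF hV hsol hk
      (a := fun n => k + 0 * (1 / ((n : ℝ) + 1))) (b := fun n => k + 1 * (1 / ((n : ℝ) + 1)))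
      (fun n => by linarith) (fun n => by linarith [hn n]) (hlim 0) (hlim 1)
    obtain ⟨r', hr', x', q', hx', hq', φ', hφ'⟩ := exists_hamiltonian_le_of_tendsto hu hF hV hsol hk
      (a := fun n => k + (-k / 2) * (1 / ((n : ℝ) + 1))) (b := fun n => k + 0 * (1 / ((n : ℝ) + 1)))
      (fun n => by nlinarith [hn n, hn1 n]) (fun n => by nlinarith [hn n]) (hlim _) (hlim 0)
    refine hamiltonian_le_of_mem_Icc hr hr' (le_of_tendsto' hφ fun n => ?_)
      (ge_of_tendsto' hφ' fun n => ?_)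
    · exact superdiff_antitone hk (by linarith [(hx (φ n)).1]) hp (hq _)
    · have h1 := hx' (φ' n)
      refine superdiff_antitone (lt_trans ?_ h1.1) (by linarith [h1.2]) (hq' _) hp
      nlinarith [hn (φ' n), hn1 (φ' n)]
  · have h := hsol.2.2.2 k hk (Ioi 0) (fun y => V k + p * (y - k)) isOpen_Ioi hk subset_rfl
      (by apply ContDiff.contDiffOn; fun_prop) (by simp)
      (fun y hy => by linarith [hp y hy])
    have hd : deriv (fun y => V k + p * (y - k)) k = p := by
      have : HasDerivAt (fun y => V k + p * (y - k)) (p * 1) k :=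
        (((hasDerivAt_id k).sub_const k).const_mul p).const_add _
      rw [this.deriv, mul_one]
    rwa [hd] at h

/-! ### The maximizer in the Hamiltonian -/

theorem utility_ne_bot (hu : UtilityAssumption u) {c k : ℝ} (hc : 0 < c) (hk : 0 < k) :
    u c k ≠ ⊥ := by
  have h := hu.increasing k hk (mem_Ioi.2 (half_pos hc)) (mem_Ioi.2 hc) (half_lt_self hc)
  exact (bot_le.trans_lt h).ne'

theorem coe_toReal_utility (hu : UtilityAssumption u) {c k : ℝ} (hc : 0 < c) (hk : 0 < k) :
    (((u c k).toReal : ℝ) : EReal) = u c k :=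
  EReal.coe_toReal (hu.ne_top c k hc.le hk.le) (utility_ne_bot hu hc hk)

theorem differentiableAt_toReal_utility (hu : UtilityAssumption u) {c k : ℝ} (hc : 0 < c)
    (hk : 0 < k) : DifferentiableAt ℝ (fun x => (u x k).toReal) c := by
  have h1 : DifferentiableAt ℝ (fun x : ℝ × ℝ => (u x.1 x.2).toReal) (c, k) :=
    (hu.contDiffOn.differentiableOn one_ne_zero).differentiableAt
      ((isOpen_Ioi.prod isOpen_Ioi).mem_nhds ⟨hc, hk⟩)
  exact DifferentiableAt.comp (g := fun x : ℝ × ℝ => (u x.1 x.2).toReal) (f := fun x => (x, k)) c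
    h1 (by fun_prop)

theorem strictConcaveOn_toReal_utility (hu : UtilityAssumption u)
    (hm : MarginalUtilityAssumption u) {k : ℝ} (hk : 0 < k) :
    StrictConcaveOn ℝ (Ioi 0) fun c => (u c k).toReal := by
  refine StrictAntiOn.strictConcaveOn_of_deriv (convex_Ioi 0)
    (fun c hc => (differentiableAt_toReal_utility hu hc hk).continuousAt.continuousWithinAt) ?_
  rw [interior_Ioi]
  exact hm.uc_decreasing k hk

theorem concaveOn_technology (hF : TechnologyAssumption W F) {k : ℝ} (hk : 0 ≤ k) :
    ConcaveOn ℝ (Ici 0) fun c => F k c := by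
  refine ⟨convex_Ici 0, fun x hx y hy a b ha hb hab => ?_⟩
  have h := hF.concave.2 (x := (k, x)) ⟨hk, hx⟩ (y := (k, y)) ⟨hk, hy⟩ ha hb hab
  have hk' : a * k + b * k = k := by rw [← add_mul, hab, one_mul]
  simpa [hk'] using h

theorem concaveOn_technology_left (hF : TechnologyAssumption W F) {c : ℝ} (hc : 0 ≤ c) :
    ConcaveOn ℝ (Ici 0) fun k => F k c := by
  refine ⟨convex_Ici 0, fun x hx y hy a b ha hb hab => ?_⟩
  have h := hF.concave.2 (x := (x, c)) ⟨hx, hc⟩ (y := (y, c)) ⟨hy, hc⟩ ha hb hab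
  have hk' : a * c + b * c = c := by rw [← add_mul, hab, one_mul]
  simpa [hk'] using h

theorem strictConcaveOn_objective (hu : UtilityAssumption u) (hF : TechnologyAssumption W F)
    (hm : MarginalUtilityAssumption u) {p k : ℝ} (hp : 0 ≤ p) (hk : 0 < k) :
    StrictConcaveOn ℝ (Ioi 0) fun c => F k c * p + (u c k).toReal := by
  have h1 : ConcaveOn ℝ (Ioi 0) fun c => F k c * p := by
    have := ((concaveOn_technology hF hk.le).subset Ioi_subset_Ici_self (convex_Ioi 0)).smul hp
    simpa [mul_comm] using this
  exact h1.add_strictConcaveOn (strictConcaveOn_toReal_utility hu hm hk)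

theorem mem_maximizers_iff {p k c : ℝ} : c ∈ maximizers u F p k ↔ 0 ≤ c ∧ ∀ c', 0 ≤ c' →
    ((F k c' * p : ℝ) : EReal) + u c' k ≤ ((F k c * p : ℝ) : EReal) + u c k := by
  refine ⟨fun h => ⟨h.1, fun c' hc' => h.2 ▸ le_hamiltonian u F p k hc'⟩, fun h => ⟨h.1, ?_⟩⟩
  exact le_antisymm (le_hamiltonian u F p k h.1) (iSup₂_le h.2)

theorem coe_objective (hu : UtilityAssumption u) {p c k : ℝ} (hc : 0 < c) (hk : 0 < k) :
    ((F k c * p + (u c k).toReal : ℝ) : EReal) = ((F k c * p : ℝ) : EReal) + u c k := by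
  rw [EReal.coe_add, coe_toReal_utility hu hc hk]

theorem objective_le (hu : UtilityAssumption u) {p k c c' : ℝ} (hk : 0 < k) (hc : 0 < c)
    (hc' : 0 < c') (h : c ∈ maximizers u F p k) :
    F k c' * p + (u c' k).toReal ≤ F k c * p + (u c k).toReal := by
  have := (mem_maximizers_iff.1 h).2 c' hc'.le
  rwa [← coe_objective hu hc hk, ← coe_objective hu hc' hk, EReal.coe_le_coe_iff] at this

/-- Infinite marginal utility at zero consumption makes every maximizer positive. -/
theorem pos_of_mem_maximizers (hu : UtilityAssumption u) (hF : TechnologyAssumption W F)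
    (hm : MarginalUtilityAssumption u) {p k c : ℝ} (hp : 0 ≤ p) (hk : 0 < k)
    (h : c ∈ maximizers u F p k) : 0 < c := by
  rw [mem_maximizers_iff] at h
  refine lt_of_le_of_ne h.1 ?_
  rintro rfl
  by_cases hbot : u 0 k = ⊥
  · have h1 := h.2 1 zero_le_one
    rw [hbot, EReal.add_bot, le_bot_iff, ← coe_objective hu one_pos hk] at h1
    exact EReal.coe_ne_bot _ h1
  have hu0 : (((u 0 k).toReal : ℝ) : EReal) = u 0 k :=
    EReal.coe_toReal (hu.ne_top 0 k le_rfl hk.le) hbot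
  obtain ⟨a, ha0, ha⟩ : ∃ a > 0, ∀ x ∈ Ioo 0 a, (F k 0 - F k 1) * p < uc u x k := by
    have := (hm.uc_zero k hk).eventually_gt_atTop ((F k 0 - F k 1) * p)
    obtain ⟨a, ha, h⟩ := mem_nhdsGT_iff_exists_Ioo_subset.1 this
    exact ⟨a, ha, h⟩
  set c := min 1 (a / 2) with hcdef
  have hc0 : 0 < c := by positivity
  have hc1 : c ≤ 1 := min_le_left _ _
  have hca : c < a := (min_le_right _ _).trans_lt (half_lt_self ha0)
  have hcont : ContinuousOn (fun x => (u x k).toReal) (Icc 0 c) := by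
    intro x hx
    rcases hx.1.eq_or_lt with rfl | hx0
    · have h1 : ContinuousWithinAt (fun x => u x k) (Icc 0 c) 0 :=
        ContinuousWithinAt.comp (g := fun x : ℝ × ℝ => u x.1 x.2) (f := fun x => (x, k))
          (hu.continuousOn (0, k) ⟨mem_Ici.2 le_rfl, hk.le⟩)
          (by fun_prop) fun x hx => ⟨hx.1, hk.le⟩
      exact (EReal.tendsto_toReal (hu.ne_top 0 k le_rfl hk.le) hbot).comp h1
    · exact (differentiableAt_toReal_utility hu hx0 hk).continuousAt.continuousWithinAt
  obtain ⟨ξ, hξ, hξd⟩ := exists_hasDerivAt_eq_slope (fun x => (u x k).toReal)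
    (fun x => uc u x k) hc0 hcont
    fun x hx => (differentiableAt_toReal_utility hu hx.1 hk).hasDerivAt
  have h2 := ha ξ ⟨hξ.1, hξ.2.trans hca⟩
  rw [hξd, lt_div_iff₀ (by linarith), sub_zero] at h2
  have h3 := (concaveOn_technology hF hk.le).2 (x := 0) self_mem_Ici (y := 1)
    (mem_Ici.2 zero_le_one) (sub_nonneg.2 hc1) hc0.le (by ring)
  simp only [smul_eq_mul, mul_zero, zero_add, mul_one] at h3
  have h4 := h.2 c hc0.le
  rw [← coe_objective hu hc0 hk, ← hu0, ← EReal.coe_add, EReal.coe_le_coe_iff] at h4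
  nlinarith

theorem maximizers_subsingleton (hu : UtilityAssumption u) (hF : TechnologyAssumption W F)
    (hm : MarginalUtilityAssumption u) {p k : ℝ} (hp : 0 ≤ p) (hk : 0 < k) :
    (maximizers u F p k).Subsingleton := by
  intro c hc d hd
  have hc0 := pos_of_mem_maximizers hu hF hm hp hk hc
  have hd0 := pos_of_mem_maximizers hu hF hm hp hk hd
  refine (strictConcaveOn_objective hu hF hm hp hk).eq_of_isMaxOn (fun x hx => ?_) (fun x hx => ?_)
    hc0 hd0
  · exact objective_le hu hk hc0 hx hc
  · exact objective_le hu hk hd0 hx hd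

/-- Since `F` decreases at least linearly in `c` and the marginal utility vanishes at infinity,
the objective is eventually decreasing, so a maximizer exists. -/
theorem maximizers_nonempty (hu : UtilityAssumption u) (hF : TechnologyAssumption W F)
    (hm : MarginalUtilityAssumption u) {p k : ℝ} (hp : 0 < p) (hk : 0 < k) :
    (maximizers u F p k).Nonempty := by
  have hFd : F k 1 < F k 0 :=
    hF.decreasing k hk.le self_mem_Ici (mem_Ici.2 zero_le_one) one_pos
  set s := F k 0 - F k 1 with hs
  have hs0 : 0 < s := by rw [hs]; linarith
  obtain ⟨c₀, hc₀1, hc₀⟩ : ∃ c₀, 1 < c₀ ∧ uc u c₀ k < s * p :=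
    ((eventually_gt_atTop 1).and
      ((hm.uc_infty k hk).eventually (gt_mem_nhds (mul_pos hs0 hp)))).exists
  have hc₀0 : 0 < c₀ := by linarith
  have hlarge : ∀ c, c₀ < c → F k c * p + (u c k).toReal ≤ F k c₀ * p + (u c₀ k).toReal := by
    intro c hc
    have h1' := (concaveOn_technology hF hk.le).slope_anti_adjacent (x := 0) (y := c₀) (z := c)
      self_mem_Ici (mem_Ici.2 (by linarith)) hc₀0 hc
    have h1'' := (concaveOn_technology hF hk.le).slope_anti_adjacent (x := 0) (y := 1) (z := c₀)
      self_mem_Ici (mem_Ici.2 (by linarith)) one_pos hc₀1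
    have h2 := (strictConcaveOn_toReal_utility hu hm hk).concaveOn.slope_le_of_hasDerivAt
      (mem_Ioi.2 hc₀0) (mem_Ioi.2 (hc₀0.trans hc)) hc
      (differentiableAt_toReal_utility hu hc₀0 hk).hasDerivAt
    rw [slope_def_field, div_le_iff₀ (by linarith)] at h2
    have h3 : F k c - F k c₀ ≤ -s * (c - c₀) := by
      rw [sub_zero, div_one, div_le_iff₀ (by linarith)] at h1''
      rw [sub_zero, div_le_iff₀ (by linarith), div_mul_eq_mul_div, le_div_iff₀ hc₀0] at h1'
      have h4 : F k c₀ - F k 0 ≤ -s * c₀ := by rw [hs]; linarith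
      have h5 : (F k c₀ - F k 0) * (c - c₀) ≤ -s * c₀ * (c - c₀) :=
        mul_le_mul_of_nonneg_right h4 (by linarith)
      have h6 : (F k c - F k c₀) * c₀ ≤ (-s * (c - c₀)) * c₀ := by linarith
      exact le_of_mul_le_mul_right h6 hc₀0
    have h7 : uc u c₀ k * (c - c₀) ≤ s * p * (c - c₀) :=
      mul_le_mul_of_nonneg_right hc₀.le (by linarith)
    have h8 := mul_le_mul_of_nonneg_right h3 hp.le
    have h2' : (u c k).toReal - (u c₀ k).toReal ≤ uc u c₀ k * (c - c₀) := h2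
    nlinarith
  have hcont : ContinuousOn (fun c => ((F k c * p : ℝ) : EReal) + u c k) (Icc 0 c₀) := by
    intro c hc
    have h1 : ContinuousWithinAt (fun x => u x k) (Icc 0 c₀) c :=
      ContinuousWithinAt.comp (g := fun x : ℝ × ℝ => u x.1 x.2) (f := fun x => (x, k))
        (hu.continuousOn (c, k) ⟨hc.1, hk.le⟩) (by fun_prop) fun x hx => ⟨hx.1, hk.le⟩
    have h2 : ContinuousWithinAt (fun x => F k x) (Icc 0 c₀) c :=
      ContinuousWithinAt.comp (g := fun x : ℝ × ℝ => F x.1 x.2) (f := fun x => (k, x))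
        (hF.continuousOn (k, c) ⟨hk.le, hc.1⟩) (by fun_prop) fun x hx => ⟨hk.le, hx.1⟩
    exact (EReal.continuousAt_add (p := (((F k c * p : ℝ) : EReal), u c k))
      (Or.inl (EReal.coe_ne_top _)) (Or.inl (EReal.coe_ne_bot _))).tendsto.comp
      ((EReal.tendsto_coe.2 (h2.tendsto.mul_const p)).prodMk_nhds h1)
  obtain ⟨c, hc, hmax⟩ := isCompact_Icc.exists_isMaxOn (nonempty_Icc.2 hc₀0.le) hcont
  refine ⟨c, mem_maximizers_iff.2 ⟨hc.1, fun c' hc' => ?_⟩⟩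
  rcases le_or_gt c' c₀ with h | h
  · exact hmax ⟨hc', h⟩
  · refine le_trans ?_ (hmax ⟨hc₀0.le, le_rfl⟩)
    dsimp only
    rw [← coe_objective hu hc₀0 hk, ← coe_objective hu (hc₀0.trans h) hk, EReal.coe_le_coe_iff]
    exact hlarge c' h

/-- The maximizer depends continuously on costate and capital: strict concavity separates the
maximum from the values at nearby points on both sides, and this survives small perturbations. -/
theorem tendsto_maximizers (hu : UtilityAssumption u) (hF : TechnologyAssumption W F)
    (hm : MarginalUtilityAssumption u) {p k c : ℝ} (hp : 0 ≤ p) (hk : 0 < k)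
    (hc : c ∈ maximizers u F p k) {q x d : ℕ → ℝ} (hq0 : ∀ n, 0 ≤ q n) (hx0 : ∀ n, 0 < x n)
    (hq : Tendsto q atTop (𝓝 p)) (hx : Tendsto x atTop (𝓝 k))
    (hd : ∀ n, d n ∈ maximizers u F (q n) (x n)) : Tendsto d atTop (𝓝 c) := by
  have hc0 := pos_of_mem_maximizers hu hF hm hp hk hc
  have hd0 := fun n => pos_of_mem_maximizers hu hF hm (hq0 n) (hx0 n) (hd n)
  have hlim : ∀ e, 0 < e → Tendsto (fun n => F (x n) e * q n + (u e (x n)).toReal) atTop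
      (𝓝 (F k e * p + (u e k).toReal)) := by
    intro e he
    have h1 : Tendsto (fun n => (x n, e)) atTop (𝓝[quadrant] (k, e)) :=
      tendsto_nhdsWithin_iff.2 ⟨hx.prodMk_nhds tendsto_const_nhds,
        Eventually.of_forall fun n => ⟨(hx0 n).le, he.le⟩⟩
    have h2 : Tendsto (fun n => F (x n) e) atTop (𝓝 (F k e)) :=
      (hF.continuousOn (k, e) ⟨hk.le, he.le⟩).tendsto.comp h1
    have h3 : ContinuousAt (fun x : ℝ × ℝ => (u x.1 x.2).toReal) (e, k) :=
      hu.contDiffOn.continuousOn.continuousAt ((isOpen_Ioi.prod isOpen_Ioi).mem_nhds ⟨he, hk⟩)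
    exact (h2.mul hq).add (h3.tendsto.comp (tendsto_const_nhds.prodMk_nhds hx))
  have hstrict : ∀ e, 0 < e → e ≠ c →
      ∀ᶠ n in atTop, F (x n) e * q n + (u e (x n)).toReal
        < F (x n) c * q n + (u c (x n)).toReal := by
    intro e he hec
    refine (hlim e he).eventually_lt (hlim c hc0) (lt_of_le_of_ne (objective_le hu hk hc0 he hc) ?_)
    intro heq
    refine hec ((strictConcaveOn_objective hu hF hm hp hk).eq_of_isMaxOn (fun y hy => ?_)
      (fun y hy => ?_) he hc0)
    · exact (objective_le hu hk hc0 hy hc).trans heq.ge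
    · exact objective_le hu hk hc0 hy hc
  have hconc := fun n => (strictConcaveOn_objective hu hF hm (hq0 n) (hx0 n)).concaveOn
  rw [tendsto_order]
  refine ⟨fun a ha => ?_, fun b hb => ?_⟩
  · have ha' : max a (c / 2) < c := max_lt ha (half_lt_self hc0)
    have ha0 : 0 < max a (c / 2) := lt_max_of_lt_right (half_pos hc0)
    filter_upwards [hstrict _ ha0 ha'.ne] with n hn
    by_contra hlt
    push Not at hlt
    have h1 := (hconc n).min_le_of_mem_Icc (mem_Ioi.2 (hd0 n)) (mem_Ioi.2 hc0)
      ⟨hlt.trans (le_max_left a (c / 2)), ha'.le⟩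
    rw [min_eq_right (objective_le hu (hx0 n) (hd0 n) hc0 (hd n))] at h1
    linarith
  · filter_upwards [hstrict b (hc0.trans hb) hb.ne'] with n hn
    by_contra hlt
    push Not at hlt
    have h1 := (hconc n).min_le_of_mem_Icc (mem_Ioi.2 hc0) (mem_Ioi.2 (hd0 n)) ⟨hb.le, hlt⟩
    rw [min_eq_left (objective_le hu (hx0 n) (hd0 n) hc0 (hd n))] at h1
    linarith

/-! ### The feedback policy -/

/-- The consumption prescribed at capital `k`. It is the only element of the set `policy u F V k`
(see `policy_eq_singleton`), which is here extracted as a supremum. -/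
def feedback (u : ℝ → ℝ → EReal) (F : ℝ → ℝ → ℝ) (V : ℝ → ℝ) (k : ℝ) : ℝ := sSup (policy u F V k)

/-- On the superdifferential the Hamiltonian is constant, and it is a supremum of functions affine
in the costate; hence a maximizer at the midpoint of two costates is a maximizer at both. -/
theorem maximizers_eq_of_mem_superdiff (hu : UtilityAssumption u) (hF : TechnologyAssumption W F)
    (hm : MarginalUtilityAssumption u) (hV : GrowthClass ρ F V)
    (hsol : IsViscositySolution ρ u F V) {k p q c : ℝ} (hk : 0 < k) (hp : p ∈ superdiff V k)
    (hq : q ∈ superdiff V k) (hc : c ∈ maximizers u F p k) : c ∈ maximizers u F q k := by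
  have hp0 := superdiff_pos hV.increasing hk hp
  have hq0 := superdiff_pos hV.increasing hk hq
  have hr : (p + q) / 2 ∈ superdiff V k := by
    rcases le_total p q with h | h
    · exact superdiff_ordConnected hp hq (by linarith) (by linarith)
    · exact superdiff_ordConnected hq hp (by linarith) (by linarith)
  obtain ⟨d, hd⟩ := maximizers_nonempty hu hF hm (p := (p + q) / 2) (by linarith) hk
  have hd0 := pos_of_mem_maximizers hu hF hm (by linarith) hk hd
  have hle : ∀ s ∈ superdiff V k, F k d * s + (u d k).toReal ≤ ρ * V k := by
    intro s hs
    have := le_hamiltonian u F s k hd0.le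
    rwa [hamiltonian_eq hu hF hV hsol hk hs, ← coe_objective hu hd0 hk,
      EReal.coe_le_coe_iff] at this
  have heq : F k d * ((p + q) / 2) + (u d k).toReal = ρ * V k := by
    have := hd.2
    rwa [hamiltonian_eq hu hF hV hsol hk hr, ← coe_objective hu hd0 hk,
      EReal.coe_eq_coe_iff] at this
  have hmem : ∀ s ∈ superdiff V k, F k d * s + (u d k).toReal = ρ * V k →
      d ∈ maximizers u F s k := by
    intro s hs h
    refine ⟨hd0.le, ?_⟩
    rw [hamiltonian_eq hu hF hV hsol hk hs, ← coe_objective hu hd0 hk, h]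
  have h1 := hle p hp
  have h2 := hle q hq
  have hdp := hmem p hp (by linarith)
  rw [maximizers_subsingleton hu hF hm hp0.le hk hc hdp]
  exact hmem q hq (by linarith)

theorem policy_eq_singleton (hu : UtilityAssumption u) (hF : TechnologyAssumption W F)
    (hm : MarginalUtilityAssumption u) (hV : GrowthClass ρ F V)
    (hsol : IsViscositySolution ρ u F V) {k : ℝ} (hk : 0 < k) :
    policy u F V k = {feedback u F V k} := by
  obtain ⟨p, hp⟩ := superdiff_nonempty hV.concave hk
  have hp0 := superdiff_pos hV.increasing hk hp
  obtain ⟨c, hc⟩ := maximizers_nonempty hu hF hm hp0 hk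
  have h : policy u F V k = {c} := by
    refine eq_singleton_iff_unique_mem.2 ⟨mem_biUnion hp hc, fun d hd => ?_⟩
    obtain ⟨q, hq, hd⟩ := mem_iUnion₂.1 hd
    exact maximizers_subsingleton hu hF hm hp0.le hk
      (maximizers_eq_of_mem_superdiff hu hF hm hV hsol hk hq hp hd) hc
  rw [feedback, h, csSup_singleton]

theorem feedback_mem_maximizers (hu : UtilityAssumption u) (hF : TechnologyAssumption W F)
    (hm : MarginalUtilityAssumption u) (hV : GrowthClass ρ F V)
    (hsol : IsViscositySolution ρ u F V) {k p : ℝ} (hk : 0 < k) (hp : p ∈ superdiff V k) :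
    feedback u F V k ∈ maximizers u F p k := by
  obtain ⟨c, hc⟩ := maximizers_nonempty hu hF hm (superdiff_pos hV.increasing hk hp) hk
  have h : c ∈ policy u F V k := mem_biUnion hp hc
  rw [policy_eq_singleton hu hF hm hV hsol hk, mem_singleton_iff] at h
  exact h ▸ hc

theorem feedback_pos (hu : UtilityAssumption u) (hF : TechnologyAssumption W F)
    (hm : MarginalUtilityAssumption u) (hV : GrowthClass ρ F V)
    (hsol : IsViscositySolution ρ u F V) {k : ℝ} (hk : 0 < k) : 0 < feedback u F V k := by
  obtain ⟨p, hp⟩ := superdiff_nonempty hV.concave hk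
  exact pos_of_mem_maximizers hu hF hm (superdiff_pos hV.increasing hk hp).le hk
    (feedback_mem_maximizers hu hF hm hV hsol hk hp)

theorem feedback_eq (hu : UtilityAssumption u) (hF : TechnologyAssumption W F)
    (hm : MarginalUtilityAssumption u) (hV : GrowthClass ρ F V)
    (hsol : IsViscositySolution ρ u F V) {k p : ℝ} (hk : 0 < k) (hp : p ∈ superdiff V k) :
    F k (feedback u F V k) * p + (u (feedback u F V k) k).toReal = ρ * V k := by
  have := (feedback_mem_maximizers hu hF hm hV hsol hk hp).2
  rwa [hamiltonian_eq hu hF hV hsol hk hp, ← coe_objective hu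
    (feedback_pos hu hF hm hV hsol hk) hk, EReal.coe_eq_coe_iff] at this

theorem continuousOn_feedback (hu : UtilityAssumption u) (hF : TechnologyAssumption W F)
    (hm : MarginalUtilityAssumption u) (hV : GrowthClass ρ F V)
    (hsol : IsViscositySolution ρ u F V) : ContinuousOn (feedback u F V) (Ioi 0) := by
  refine continuousOn_iff_continuous_domRestrict.2 (continuous_iff_seqContinuous.2 ?_)
  intro x k hx
  have hx : Tendsto (fun n => (x n : ℝ)) atTop (𝓝 (k : ℝ)) :=
    (continuous_subtype_val.tendsto k).comp hx
  have hk : 0 < (k : ℝ) := k.2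
  choose p hp using fun n => superdiff_nonempty hV.concave (x n).2
  refine tendsto_of_subseq_tendsto fun ns hns => ?_
  obtain ⟨q, hq, φ, hφ, hφq⟩ := exists_subseq_superdiff hV.increasing hsol.1 hk (hx.comp hns)
    (p := p ∘ ns) fun n => hp (ns n)
  refine ⟨φ, ?_⟩
  exact tendsto_maximizers hu hF hm (superdiff_pos hV.increasing hk hq).le hk
    (feedback_mem_maximizers hu hF hm hV hsol hk hq)
    (q := p ∘ ns ∘ φ) (x := fun n => x (ns (φ n)))
    (fun n => (superdiff_pos hV.increasing (x _).2 (hp _)).le) (fun n => (x _).2) hφq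
    (hx.comp (hns.comp hφ.tendsto_atTop)) fun n => feedback_mem_maximizers hu hF hm hV hsol
      (x _).2 (hp _)

theorem continuousOn_technology_feedback (hu : UtilityAssumption u) (hF : TechnologyAssumption W F)
    (hm : MarginalUtilityAssumption u) (hV : GrowthClass ρ F V)
    (hsol : IsViscositySolution ρ u F V) :
    ContinuousOn (fun k => F k (feedback u F V k)) (Ioi 0) :=
  hF.continuousOn.comp (f := fun k => (k, feedback u F V k))
    (continuousOn_id.prodMk (continuousOn_feedback hu hF hm hV hsol))
    fun _ hk => ⟨(mem_Ioi.1 hk).le, (feedback_pos hu hF hm hV hsol hk).le⟩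

/-- Capital grows under the feedback policy wherever its marginal product exceeds the discount
rate. Otherwise the Hamilton–Jacobi–Bellman equation at `k < l` would give
`ρ (V l - V k) ≥ (F l c - F k c) q` for `c` the feedback at `k` and `q` in the superdifferential at
`l`, so that `ρ p ≥ r q` with `r > ρ`, which is impossible as `l` decreases to `k`. -/
theorem technology_feedback_pos (hρ : 0 < ρ) (hu : UtilityAssumption u)
    (hF : TechnologyAssumption W F) (hm : MarginalUtilityAssumption u)
    (hl : LowCapitalAssumption ρ u F) (hV : GrowthClass ρ F V)
    (hsol : IsViscositySolution ρ u F V) :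
    ∃ δ > 0, ∀ k ∈ Ioo 0 δ, 0 < F k (feedback u F V k) := by
  obtain ⟨δ, hδ, hρδ⟩ := hl.productivity
  obtain ⟨r, hρr, hr⟩ := EReal.lt_iff_exists_real_btwn.1 hρδ
  rw [EReal.coe_lt_coe_iff] at hρr
  refine ⟨δ, hδ, fun k hk => ?_⟩
  by_contra hneg
  push Not at hneg
  have hk0 : 0 < k := hk.1
  set c := feedback u F V k with hc
  have hc0 : 0 < c := feedback_pos hu hF hm hV hsol hk0
  obtain ⟨t, ht, hrt⟩ : ∃ t, 0 < t ∧ r < (F (δ + t) c - F δ c) / t := by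
    have h1 : (r : EReal) < rightDerivK F δ c := hr.trans_le (iInf₂_le c hc0.le)
    simp only [rightDerivK, lt_iSup_iff, EReal.coe_lt_coe_iff] at h1
    obtain ⟨t, ht, h⟩ := h1
    exact ⟨t, ht, h⟩
  have hconc := concaveOn_technology_left hF hc0.le
  have hslope : ∀ l, k < l → l < δ → r * (l - k) ≤ F l c - F k c := by
    intro l hkl hlδ
    have h1 := hconc.slope_anti_adjacent (mem_Ici.2 hk0.le) (mem_Ici.2 hδ.le) hkl hlδ
    have h2 := hconc.slope_anti_adjacent (mem_Ici.2 (hk0.trans hkl).le)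
      (mem_Ici.2 (by linarith : 0 ≤ δ + t)) hlδ (by linarith)
    rw [add_sub_cancel_left] at h2
    rw [← le_div_iff₀ (by linarith)]
    linarith
  have hcomp : ∀ l, k < l → l < δ → ∀ p ∈ superdiff V k, ∀ q ∈ superdiff V l, r * q ≤ ρ * p := by
    intro l hkl hlδ p hp q hq
    have hl0 := hk0.trans hkl
    have hqp := superdiff_antitone hk0 hkl hp hq
    have hq0 := superdiff_pos hV.increasing hl0 hq
    have h1 := feedback_eq hu hF hm hV hsol hk0 hp
    have h2 := le_hamiltonian u F q l hc0.le
    rw [hamiltonian_eq hu hF hV hsol hl0 hq, ← coe_objective hu hc0 hl0,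
      EReal.coe_le_coe_iff] at h2
    have h3 : (u c k).toReal ≤ (u c l).toReal :=
      EReal.toReal_le_toReal (hu.nondecreasing c c k l hc0.le le_rfl hk0.le hkl.le)
        (utility_ne_bot hu hc0 hk0) (hu.ne_top c l hc0.le hl0.le)
    have h4 := hp l hl0
    have h5 := mul_le_mul_of_nonneg_right (hslope l hkl hlδ) hq0.le
    have h6 : 0 ≤ F k c * (q - p) := mul_nonneg_of_nonpos_of_nonpos hneg (by linarith)
    have h7 : (r * q) * (l - k) ≤ (ρ * p) * (l - k) := by nlinarith
    exact le_of_mul_le_mul_right h7 (by linarith)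
  have hx : Tendsto (fun n : ℕ => k + (δ - k) / 2 * (1 / ((n : ℝ) + 1))) atTop (𝓝 k) := by
    simpa using (tendsto_one_div_add_atTop_nhds_zero_nat.const_mul ((δ - k) / 2)).const_add k
  have hn : ∀ n : ℕ, 0 < 1 / ((n : ℝ) + 1) := fun n => by positivity
  have hn1 : ∀ n : ℕ, 1 / ((n : ℝ) + 1) ≤ 1 := fun n => by
    rw [div_le_one (by positivity)]; linarith [n.cast_nonneg (α := ℝ)]
  have hgt : ∀ n : ℕ, k < k + (δ - k) / 2 * (1 / ((n : ℝ) + 1)) := fun n => by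
    nlinarith [hn n, hk.2, mul_pos (sub_pos.2 hk.2) (hn n)]
  have hlt : ∀ n : ℕ, k + (δ - k) / 2 * (1 / ((n : ℝ) + 1)) < δ := fun n => by
    nlinarith [hn1 n, hk.2, mul_le_mul_of_nonneg_left (hn1 n) (sub_pos.2 hk.2).le]
  choose q hq using fun n => superdiff_nonempty hV.concave (hk0.trans (hgt n))
  obtain ⟨p, hp, φ, -, hφ⟩ := exists_subseq_superdiff hV.increasing hsol.1 hk0 hx hq
  have h1 := le_of_tendsto' (hφ.const_mul r) fun n => hcomp _ (hgt _) (hlt _) p hp _ (hq (φ n))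
  have hp0 := superdiff_pos hV.increasing hk0 hp
  nlinarith

/-! ### The discounted value along a path -/

theorem absolutelyContinuousOnInterval_comp {g f : ℝ → ℝ} {K : NNReal} {s : Set ℝ}
    {a b : ℝ} (hg : LipschitzOnWith K g s) (hf : AbsolutelyContinuousOnInterval f a b)
    (hs : MapsTo f (uIcc a b) s) : AbsolutelyContinuousOnInterval (fun t => g (f t)) a b := by
  rw [absolutelyContinuousOnInterval_iff] at hf ⊢
  intro ε hε
  obtain ⟨δ, hδ, h⟩ := hf (ε / (K + 1)) (by positivity)
  refine ⟨δ, hδ, fun E hE hEδ => ?_⟩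
  calc ∑ i ∈ Finset.range E.1, dist (g (f (E.2 i).1)) (g (f (E.2 i).2))
      ≤ ∑ i ∈ Finset.range E.1, K * dist (f (E.2 i).1) (f (E.2 i).2) :=
        Finset.sum_le_sum fun i hi =>
          hg.dist_le_mul _ (hs (hE.1 i hi).1) _ (hs (hE.1 i hi).2)
    _ = K * ∑ i ∈ Finset.range E.1, dist (f (E.2 i).1) (f (E.2 i).2) := by rw [Finset.mul_sum]
    _ ≤ K * (ε / (K + 1)) := mul_le_mul_of_nonneg_left (h E hE hEδ).le K.2
    _ < ε := by
        rw [mul_div_assoc', div_lt_iff₀ (by positivity)]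
        nlinarith [K.2]

/-- The value `e^{-ρt} V(k(t))`, discounted to time `0`, of the capital reached at time `t`. -/
def discountedValue (ρ : ℝ) (V k : ℝ → ℝ) (t : ℝ) : ℝ := Real.exp (-ρ * t) * V (k t)

theorem absolutelyContinuousOnInterval_value (hV : GrowthClass ρ F V) {k : ℝ → ℝ}
    (hk : LocallyAC k) (hb : BoundedAwayFromZero k) {T : ℝ} (hT : 0 ≤ T) :
    AbsolutelyContinuousOnInterval (fun t => V (k t)) 0 T := by
  obtain ⟨ε, hε, hkε⟩ := hb
  obtain ⟨p, hp⟩ := superdiff_nonempty hV.concave (half_pos hε)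
  have hLip : LipschitzOnWith p.toNNReal V (Ioi (ε / 2)) := by
    refine LipschitzOnWith.of_dist_le_mul fun x hx y hy => ?_
    rw [Real.dist_eq, Real.dist_eq,
      Real.coe_toNNReal p (superdiff_pos hV.increasing (half_pos hε) hp).le]
    exact abs_sub_le_of_superdiff hV.concave hV.increasing (half_pos hε) hp hx hy
  refine absolutelyContinuousOnInterval_comp hLip (hk T hT) fun t ht => ?_
  rw [uIcc_of_le hT] at ht
  exact lt_of_lt_of_le (half_lt_self hε) (hkε t ht.1)

theorem absolutelyContinuousOnInterval_discountedValue (hV : GrowthClass ρ F V) {k : ℝ → ℝ}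
    (hk : LocallyAC k) (hb : BoundedAwayFromZero k) {T : ℝ} (hT : 0 ≤ T) :
    AbsolutelyContinuousOnInterval (discountedValue ρ V k) 0 T := by
  have hexp : LocallyAC fun t => Real.exp (-ρ * t) := by
    refine locallyAC_of_hasDerivWithinAt (h := fun t => Real.exp (-ρ * t) * (-ρ * 1))
      (by fun_prop) fun t _ => ?_
    exact (((hasDerivAt_id t).const_mul (-ρ)).exp).hasDerivWithinAt
  exact (hexp T hT).fun_mul (absolutelyContinuousOnInterval_value hV hk hb hT)

/-- At a common point of differentiability the chain rule holds with every element of the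
superdifferential, since `V ∘ k - p k` has a local maximum there. -/
theorem ae_deriv_discountedValue (hV : GrowthClass ρ F V) {k d : ℝ → ℝ}
    (hk : LocallyAC k) (hb : BoundedAwayFromZero k) {T : ℝ} (hT : 0 ≤ T)
    (hd : ∀ᵐ t ∂(volume.restrict (Ici 0)), HasDerivAt k (d t) t) :
    ∀ᵐ t ∂(volume.restrict (Icc 0 T)), ∀ p ∈ superdiff V (k t),
      deriv (discountedValue ρ V k) t = Real.exp (-ρ * t) * (p * d t - ρ * V (k t)) := by
  obtain ⟨ε, hε, hkε⟩ := id hb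
  have h0 : ∀ᵐ t : ℝ ∂volume, t ≠ 0 := by simp [ae_iff, measure_singleton]
  rw [ae_restrict_iff' measurableSet_Ici] at hd
  rw [ae_restrict_iff' measurableSet_Icc]
  filter_upwards [hd, h0, (absolutelyContinuousOnInterval_value hV hk hb hT).ae_differentiableAt]
    with t hd h0 hdiff ht p hp
  have ht0 : 0 < t := lt_of_le_of_ne ht.1 (Ne.symm h0)
  have hVd := (hdiff (by rwa [uIcc_of_le hT])).hasDerivAt
  have hmax : IsLocalMax (fun s => V (k s) - p * k s) t := by
    filter_upwards [Ioi_mem_nhds ht0] with s hs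
    have := hp (k s) (hε.trans_le (hkε s (le_of_lt hs)))
    linarith
  have h1 := hmax.hasDerivAt_eq_zero (hVd.sub ((hd ht.1).const_mul p))
  have h2 := (((hasDerivAt_id t).const_mul (-ρ)).exp).mul hVd
  have h3 : deriv (discountedValue ρ V k) t = _ := h2.deriv
  rw [h3, show deriv (fun t => V (k t)) t = p * d t by linarith]
  simp only [id]
  ring

theorem coe_lintegral_sub_eq_integral {g : ℝ → ℝ} {T : ℝ} (hT : 0 ≤ T)
    (hg : IntervalIntegrable g volume 0 T) :
    ((∫⁻ t in Icc 0 T, ENNReal.ofReal (g t) : ENNReal) : EReal)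
      - ((∫⁻ t in Icc 0 T, ENNReal.ofReal (-g t) : ENNReal) : EReal)
      = ((∫ t in 0..T, g t : ℝ) : EReal) := by
  have hi : IntegrableOn g (Icc 0 T) :=
    (intervalIntegrable_iff_integrableOn_Icc_of_le hT).1 hg
  rw [intervalIntegral.integral_of_le hT, ← integral_Icc_eq_integral_Ioc,
    integral_eq_lintegral_pos_part_sub_lintegral_neg_part hi, EReal.coe_sub,
    EReal.coe_ennreal_toReal hi.lintegral_lt_top.ne,
    EReal.coe_ennreal_toReal (x := ∫⁻ t in Icc 0 T, ENNReal.ofReal (-g t))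
      hi.neg.lintegral_lt_top.ne]

theorem utility_le_of_flow_le {k c g : ℝ → ℝ} {T : ℝ} (hT : 0 ≤ T)
    (hg : IntervalIntegrable g volume 0 T)
    (h : ∀ᵐ t ∂(volume.restrict (Icc 0 T)), flow ρ u k c t ≤ (g t : EReal)) :
    utility ρ u k c T ≤ ((∫ t in 0..T, g t : ℝ) : EReal) := by
  rw [← coe_lintegral_sub_eq_integral hT hg]
  refine EReal.sub_le_sub (EReal.coe_ennreal_le_coe_ennreal_iff.2 (lintegral_mono_ae ?_))
    (EReal.coe_ennreal_le_coe_ennreal_iff.2 (lintegral_mono_ae ?_))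
  · filter_upwards [h] with t ht
    exact EReal.toENNReal_le_toENNReal ht
  · filter_upwards [h] with t ht
    exact EReal.toENNReal_le_toENNReal (x := ((-g t : ℝ) : EReal)) (by
      rw [EReal.coe_neg]; exact EReal.neg_le_neg_iff.2 ht)

theorem utility_eq_of_flow_eq {k c g : ℝ → ℝ} {T : ℝ} (hT : 0 ≤ T)
    (hg : IntervalIntegrable g volume 0 T)
    (h : ∀ᵐ t ∂(volume.restrict (Icc 0 T)), flow ρ u k c t = (g t : EReal)) :
    posUtility ρ u k c T ≠ ⊤ ∧ utility ρ u k c T = ((∫ t in 0..T, g t : ℝ) : EReal) := by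
  have hi : IntegrableOn g (Icc 0 T) :=
    (intervalIntegrable_iff_integrableOn_Icc_of_le hT).1 hg
  have h1 : posUtility ρ u k c T = ∫⁻ t in Icc 0 T, ENNReal.ofReal (g t) := by
    refine lintegral_congr_ae ?_
    filter_upwards [h] with t ht
    rw [ht, EReal.real_coe_toENNReal]
  have h2 : negUtility ρ u k c T = ∫⁻ t in Icc 0 T, ENNReal.ofReal (-g t) := by
    refine lintegral_congr_ae ?_
    filter_upwards [h] with t ht
    rw [ht, ← EReal.coe_neg, EReal.real_coe_toENNReal]
  refine ⟨h1 ▸ hi.lintegral_lt_top.ne, ?_⟩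
  rw [utility, h1, h2, coe_lintegral_sub_eq_integral hT hg]

theorem integral_neg_deriv_discountedValue (hV : GrowthClass ρ F V) {k : ℝ → ℝ}
    (hk : LocallyAC k) (hb : BoundedAwayFromZero k) {T : ℝ} (hT : 0 ≤ T) :
    IntervalIntegrable (fun t => -deriv (discountedValue ρ V k) t) volume 0 T ∧
      ∫ t in 0..T, -deriv (discountedValue ρ V k) t = V (k 0) - discountedValue ρ V k T := by
  have hac := absolutelyContinuousOnInterval_discountedValue hV hk hb hT
  refine ⟨hac.intervalIntegrable_deriv.neg, ?_⟩
  rw [intervalIntegral.integral_neg, hac.integral_deriv_eq_sub]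
  simp [discountedValue]

/-- Verification inequality: the utility collected up to time `T` is at most the loss of
discounted value. -/
theorem utility_le (hu : UtilityAssumption u) (hF : TechnologyAssumption W F)
    (hV : GrowthClass ρ F V) (hsol : IsViscositySolution ρ u F V) {k c : ℝ → ℝ}
    (hc : ∀ t, 0 ≤ t → 0 ≤ c t) (hk : LocallyAC k) (hb : BoundedAwayFromZero k)
    (hd : ∀ᵐ t ∂(volume.restrict (Ici 0)), HasDerivAt k (F (k t) (c t)) t)
    {T : ℝ} (hT : 0 ≤ T) :
    utility ρ u k c T ≤ ((V (k 0) - discountedValue ρ V k T : ℝ) : EReal) := by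
  obtain ⟨hi, hint⟩ := integral_neg_deriv_discountedValue hV hk hb hT
  rw [← hint]
  refine utility_le_of_flow_le hT hi ?_
  filter_upwards [ae_deriv_discountedValue hV hk hb hT hd, ae_restrict_mem measurableSet_Icc]
    with t ht htT
  obtain ⟨ε, hε, hkε⟩ := hb
  have hkt : 0 < k t := hε.trans_le (hkε t htT.1)
  obtain ⟨p, hp⟩ := superdiff_nonempty hV.concave hkt
  have hexp := Real.exp_pos (-ρ * t)
  have hH := le_hamiltonian u F p (k t) (hc t htT.1)
  rw [hamiltonian_eq hu hF hV hsol hkt hp] at hH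
  rw [ht p hp, flow]
  by_cases hbot : u (c t) (k t) = ⊥
  · rw [hbot, EReal.coe_mul_bot_of_pos hexp]
    exact bot_le
  · rw [← EReal.coe_toReal (hu.ne_top _ _ (hc t htT.1) hkt.le) hbot, ← EReal.coe_add,
      EReal.coe_le_coe_iff] at hH
    rw [← EReal.coe_toReal (hu.ne_top _ _ (hc t htT.1) hkt.le) hbot, ← EReal.coe_mul,
      EReal.coe_le_coe_iff, ← mul_neg]
    refine mul_le_mul_of_nonneg_left ?_ hexp.le
    linarith

/-- Along the feedback policy the verification inequality is an equality. -/
theorem utility_feedback_eq (hu : UtilityAssumption u) (hF : TechnologyAssumption W F)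
    (hm : MarginalUtilityAssumption u) (hV : GrowthClass ρ F V)
    (hsol : IsViscositySolution ρ u F V) {k c : ℝ → ℝ}
    (hc : ∀ t, 0 ≤ t → c t = feedback u F V (k t)) (hk : LocallyAC k)
    (hb : BoundedAwayFromZero k)
    (hd : ∀ᵐ t ∂(volume.restrict (Ici 0)), HasDerivAt k (F (k t) (c t)) t)
    {T : ℝ} (hT : 0 ≤ T) :
    posUtility ρ u k c T ≠ ⊤ ∧
      utility ρ u k c T = ((V (k 0) - discountedValue ρ V k T : ℝ) : EReal) := by
  obtain ⟨hi, hint⟩ := integral_neg_deriv_discountedValue hV hk hb hT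
  rw [← hint]
  refine utility_eq_of_flow_eq hT hi ?_
  filter_upwards [ae_deriv_discountedValue hV hk hb hT hd, ae_restrict_mem measurableSet_Icc]
    with t ht htT
  obtain ⟨ε, hε, hkε⟩ := hb
  have hkt : 0 < k t := hε.trans_le (hkε t htT.1)
  obtain ⟨p, hp⟩ := superdiff_nonempty hV.concave hkt
  have h1 := feedback_eq hu hF hm hV hsol hkt hp
  have h2 := coe_toReal_utility hu (feedback_pos hu hF hm hV hsol hkt) hkt
  rw [ht p hp, flow, hc t htT.1, ← h2, ← EReal.coe_mul, EReal.coe_eq_coe_iff, ← mul_neg]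
  congr 1
  linarith

/-! ### Pure accumulation -/

theorem continuousOn_pureAccumulation (hF : TechnologyAssumption W F) :
    ContinuousOn (fun k => F k 0) (Ici 0) :=
  hF.continuousOn.comp (f := fun k : ℝ => (k, (0 : ℝ))) (by fun_prop)
    fun _ hk => ⟨hk, mem_Ici.2 le_rfl⟩

theorem exists_pureAccumulation_pos (hF : TechnologyAssumption W F) :
    ∃ δ > 0, ∀ k ∈ Ioo 0 δ, 0 < F k 0 := by
  obtain ⟨δ, hδ, h⟩ := hF.productive 0 le_rfl
  rw [hF.zero] at h
  refine ⟨δ, hδ, fun k hk => ?_⟩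
  have h1 := (concaveOn_technology_left hF le_rfl).slope_anti_adjacent self_mem_Ici
    (mem_Ici.2 hδ.le) hk.1 hk.2
  rw [hF.zero, sub_zero, sub_zero, div_le_div_iff₀ (by linarith [hk.2]) hk.1] at h1
  by_contra hneg
  nlinarith [mul_pos h hk.1, mul_nonneg (neg_nonneg.2 (not_lt.1 hneg)) (sub_nonneg.2 hk.2.le)]

theorem exists_pureAccumulation_le (hF : TechnologyAssumption W F) :
    ∃ C, ∀ k, 0 ≤ k → F k 0 ≤ C * (1 + k) := by
  obtain ⟨M, hM⟩ := isCompact_Icc.exists_bound_of_continuousOn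
    ((continuousOn_pureAccumulation hF).mono (Icc_subset_Ici_self : Icc (0 : ℝ) 1 ⊆ Ici 0))
  have hM0 : 0 ≤ M := (norm_nonneg _).trans (hM 0 ⟨le_rfl, zero_le_one⟩)
  refine ⟨M, fun k hk => ?_⟩
  rcases le_or_gt k 1 with h | h
  · have := (le_abs_self _).trans (hM k ⟨hk, h⟩)
    nlinarith
  · have h1 := (concaveOn_technology_left hF le_rfl).slope_anti_adjacent (x := 0) (y := 1)
      self_mem_Ici (mem_Ici.2 hk) one_pos h
    rw [hF.zero, sub_zero, sub_zero, div_one, div_le_iff₀ (by linarith)] at h1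
    have h2 := (le_abs_self _).trans (hM 1 ⟨zero_le_one, le_rfl⟩)
    nlinarith

theorem boundedAwayFromZero_of_pos_near_zero {f k : ℝ → ℝ} {δ : ℝ} (hδ : 0 < δ)
    (hf : ∀ x ∈ Ioo 0 δ, 0 < f x) (hc : ContinuousOn k (Ici 0)) (hpos : ∀ t, 0 ≤ t → 0 < k t)
    (hd : ∀ t, 0 < t → HasDerivAt k (f (k t)) t) : BoundedAwayFromZero k := by
  refine ⟨min (k 0) δ, lt_min (hpos 0 le_rfl) hδ, ?_⟩
  refine le_of_hasDerivAt_nonneg_of_lt hc (min_le_left _ _) fun t ht hlt => ⟨_, ?_, hd t ht⟩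
  exact (hf _ ⟨hpos t ht.le, hlt.trans_le (min_le_right _ _)⟩).le

/-- A path whose growth never exceeds that of pure accumulation stays below a pure accumulation
path with the same initial value. -/
theorem exists_pureAccumulationPath_ge (hF : TechnologyAssumption W F) {f k : ℝ → ℝ}
    (hc : ContinuousOn k (Ici 0)) (hpos : ∀ t, 0 ≤ t → 0 < k t)
    (hd : ∀ t, 0 < t → HasDerivAt k (f (k t)) t) (hf : ∀ x, 0 < x → f x ≤ F x 0) :
    ∃ κ, IsPureAccumulationPath F (k 0) κ ∧ ∀ t, 0 ≤ t → k t ≤ κ t := by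
  obtain ⟨δ, hδ, hFδ⟩ := exists_pureAccumulation_pos hF
  obtain ⟨C, hC⟩ := exists_pureAccumulation_le hF
  obtain ⟨κ, hκ0, hκpos, hκAC, hκd⟩ := exists_positive_solution
    ((continuousOn_pureAccumulation hF).mono Ioi_subset_Ici_self) hδ hFδ
    (fun x hx => hC x hx.le) (hpos 0 le_rfl)
  have hκae : ∀ᵐ t ∂(volume.restrict (Ici 0)), HasDerivAt κ (F (κ t) 0) t := by
    have h0 : ∀ᵐ t : ℝ ∂volume, t ≠ 0 := by simp [ae_iff, measure_singleton]
    rw [ae_restrict_iff' measurableSet_Ici]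
    filter_upwards [h0] with t h0 ht
    exact hκd t (lt_of_le_of_ne ht (Ne.symm h0))
  refine ⟨κ, ⟨fun t ht => (hκpos t ht).le, hκAC, hκ0, hκae⟩, ?_⟩
  have hκc : ContinuousOn κ (Ici 0) := (hasDerivAt_of_locallyAC
    ((continuousOn_pureAccumulation hF).mono Ioi_subset_Ici_self) hκAC hκpos hκae).1
  obtain ⟨m, hm, hκm⟩ := boundedAwayFromZero_of_pos_near_zero hδ hFδ hκc hκpos hκd
  have hconc : ConcaveOn ℝ (Ioi 0) fun x => F x 0 :=
    (concaveOn_technology_left hF le_rfl).subset Ioi_subset_Ici_self (convex_Ioi 0)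
  -- a one-sided Lipschitz constant of pure accumulation along `κ`
  obtain ⟨q, hq⟩ := superdiff_nonempty hconc (half_pos hm)
  have hexp : ∀ t, HasDerivAt (fun t => Real.exp (-q * t)) (Real.exp (-q * t) * (-q * 1)) t :=
    fun t => ((hasDerivAt_id t).const_mul (-q)).exp
  have hle : ∀ t, 0 ≤ t → 0 ≤ Real.exp (-q * t) * (κ t - k t) := by
    refine le_of_hasDerivAt_nonneg_of_lt (ContinuousOn.mul (by fun_prop) (hκc.sub hc))
      (by simp [hκ0]) fun t ht hlt => ⟨_, ?_, (hexp t).mul ((hκd t ht).sub (hd t ht))⟩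
    have hlt' : κ t < k t := by
      by_contra hge
      exact absurd hlt (not_lt.2 (mul_nonneg (Real.exp_pos _).le (by linarith)))
    obtain ⟨p, hp⟩ := superdiff_nonempty hconc (hκpos t ht.le)
    have hpq : p ≤ q := superdiff_antitone (half_pos hm)
      ((half_lt_self hm).trans_le (hκm t ht.le)) hq hp
    have h1 := hp (k t) (hpos t ht.le)
    have h2 := hf (k t) (hpos t ht.le)
    have h3 : p * (k t - κ t) ≤ q * (k t - κ t) := mul_le_mul_of_nonneg_right hpq (by linarith)
    have h4 : 0 ≤ Real.exp (-q * t) * (-q * (κ t - k t) + (F (κ t) 0 - f (k t))) :=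
      mul_nonneg (Real.exp_pos _).le (by linarith)
    calc 0 ≤ _ := h4
      _ = _ := by ring
  intro t ht
  linarith [nonneg_of_mul_nonneg_right (hle t ht) (Real.exp_pos _)]

theorem tendsto_exp_mul_const (hρ : 0 < ρ) (a : ℝ) :
    Tendsto (fun T : ℝ => Real.exp (-ρ * T) * a) atTop (𝓝 0) := by
  have h : Tendsto (fun T : ℝ => -ρ * T) atTop atBot :=
    tendsto_id.const_mul_atTop_of_neg (neg_lt_zero.2 hρ)
  simpa using (Real.tendsto_exp_atBot.comp h).mul_const a

theorem tendsto_discountedValue (hρ : 0 < ρ) (hF : TechnologyAssumption W F)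
    (hV : GrowthClass ρ F V) {f k : ℝ → ℝ} (hc : ContinuousOn k (Ici 0))
    (hb : BoundedAwayFromZero k) (hd : ∀ t, 0 < t → HasDerivAt k (f (k t)) t)
    (hf : ∀ x, 0 < x → f x ≤ F x 0) :
    Tendsto (discountedValue ρ V k) atTop (𝓝 0) := by
  obtain ⟨m, hm, hkm⟩ := hb
  have hpos : ∀ t, 0 ≤ t → 0 < k t := fun t ht => hm.trans_le (hkm t ht)
  obtain ⟨κ, hκ, hkκ⟩ := exists_pureAccumulationPath_ge hF hc hpos hd hf
  have hup := hV.growth (k 0) (hpos 0 le_rfl) κ hκ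
  refine tendsto_of_tendsto_of_tendsto_of_le_of_le' (tendsto_exp_mul_const hρ (V m)) hup ?_ ?_
  · filter_upwards [eventually_ge_atTop 0] with t ht
    exact mul_le_mul_of_nonneg_left (hV.increasing.monotoneOn hm (hpos t ht) (hkm t ht))
      (Real.exp_pos _).le
  · filter_upwards [eventually_ge_atTop 0] with t ht
    exact mul_le_mul_of_nonneg_left (hV.increasing.monotoneOn (hpos t ht)
      (mem_Ioi.2 ((hpos t ht).trans_le (hkκ t ht))) (hkκ t ht)) (Real.exp_pos _).le

end EconGrowth

end

theorem proposition4
    (ρ : ℝ) (W : Set (ℝ → ℝ)) (u : ℝ → ℝ → EReal) (F : ℝ → ℝ → ℝ)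
    (hρ : 0 < ρ) (hW : W = W₁ ∨ W = W₂)
    (hu : UtilityAssumption u) (hF : TechnologyAssumption W F)
    (hm : MarginalUtilityAssumption u) (hl : LowCapitalAssumption ρ u F)
    (V : ℝ → ℝ) (hV : GrowthClass ρ F V) (hsol : IsViscositySolution ρ u F V)
    (k₀ : ℝ) (hk₀ : 0 < k₀) :
    (∃ kst : ℝ → ℝ, IsGlobalSolution (fun k => F k '' policy u F V k) k₀ kst) ∧
    (∀ kst : ℝ → ℝ, IsGlobalSolution (fun k => F k '' policy u F V k) k₀ kst →
      BoundedAwayFromZero kst ∧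
      (∀ t, 0 ≤ t → ∃! c, c ∈ nearest (policy u F V (kst t)) kst t) ∧
      ∀ cst : ℝ → ℝ, (∀ t, 0 ≤ t → cst t ∈ nearest (policy u F V (kst t)) kst t) →
        LocallyBounded cst ∧ (kst, cst) ∈ B ρ W u F k₀ ∧
        Filter.Tendsto (utility ρ u kst cst) Filter.atTop (nhds (V k₀ : EReal))) ∧
    (∀ k c : ℝ → ℝ, (k, c) ∈ B ρ W u F k₀ → BoundedAwayFromZero k →
      ∀ L : EReal, Filter.Tendsto (utility ρ u k c) Filter.atTop (nhds L) →
        L ≤ (V k₀ : EReal)) := by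
  have hpol : ∀ k, 0 < k → policy u F V k = {feedback u F V k} := fun k hk =>
    policy_eq_singleton hu hF hm hV hsol hk
  have hcont := continuousOn_technology_feedback hu hF hm hV hsol
  obtain ⟨δ, hδ, hfδ⟩ := technology_feedback_pos hρ hu hF hm hl hV hsol
  have hfF : ∀ x, 0 < x → F x (feedback u F V x) ≤ F x 0 := fun x hx =>
    (hF.decreasing x hx.le).antitoneOn self_mem_Ici
      (mem_Ici.2 (feedback_pos hu hF hm hV hsol hx).le) (feedback_pos hu hF hm hV hsol hx).le
  refine ⟨?_, ?_, ?_⟩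
  · obtain ⟨C, hC⟩ := exists_pureAccumulation_le hF
    obtain ⟨k, h0, hpos, hAC, hd⟩ := exists_positive_solution hcont hδ hfδ
      (fun x hx => (hfF x hx).trans (hC x hx.le)) hk₀
    refine ⟨k, hpos, hAC, h0, ?_⟩
    have hne : ∀ᵐ t : ℝ ∂volume, t ≠ 0 := by
      simp [ae_iff, measure_singleton]
    rw [ae_restrict_iff' measurableSet_Ici]
    filter_upwards [hne] with t hne ht
    refine ⟨_, ⟨feedback u F V (k t), ?_, rfl⟩, hd t (lt_of_le_of_ne ht (Ne.symm hne))⟩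
    rw [hpol _ (hpos t ht)]
    exact mem_singleton _
  · rintro k ⟨hpos, hAC, h0, hd⟩
    have hd' : ∀ᵐ t ∂(volume.restrict (Ici 0)),
        HasDerivAt k (F (k t) (feedback u F V (k t))) t := by
      filter_upwards [hd, ae_restrict_mem measurableSet_Ici] with t ht ht0
      obtain ⟨_, ⟨c, hc, rfl⟩, hy⟩ := ht
      rw [hpol _ (hpos t ht0), mem_singleton_iff] at hc
      exact hc ▸ hy
    obtain ⟨hkc, hkd⟩ := hasDerivAt_of_locallyAC hcont hAC hpos hd'
    have hb : BoundedAwayFromZero k := boundedAwayFromZero_of_pos_near_zero hδ hfδ hkc hpos hkd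
    refine ⟨hb, fun t ht => ?_, fun c hc => ?_⟩
    · rw [hpol _ (hpos t ht)]
      exact ⟨feedback u F V (k t), ⟨rfl, fun c' hc' => by rw [mem_singleton_iff.1 hc']⟩,
        fun y hy => hy.1⟩
    · have hcf : ∀ t, 0 ≤ t → c t = feedback u F V (k t) := fun t ht => by
        have := (hc t ht).1
        rwa [hpol _ (hpos t ht), mem_singleton_iff] at this
      have hcc : ContinuousOn c (Ici 0) :=
        ((continuousOn_feedback hu hF hm hV hsol).comp hkc fun t ht => hpos t ht).congr hcf
      have hc0 : ∀ t, 0 ≤ t → 0 ≤ c t := fun t ht => by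
        rw [hcf t ht]; exact (feedback_pos hu hF hm hV hsol (hpos t ht)).le
      have hcb : LocallyBounded c := fun T _ =>
        isCompact_Icc.exists_bound_of_continuousOn (hcc.mono Icc_subset_Ici_self)
      have hcW : c ∈ W := by
        rcases hW with rfl | rfl
        · exact ⟨hc0, fun T _ => (hcc.mono Icc_subset_Ici_self).integrableOn_Icc⟩
        · exact ⟨hc0, hcc.aemeasurable measurableSet_Ici, hcb⟩
      have hdc : ∀ᵐ t ∂(volume.restrict (Ici 0)),
          HasDerivAt k (F (k t) (c t)) t := by
        filter_upwards [hd', ae_restrict_mem measurableSet_Ici] with t ht ht0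
        rwa [hcf t ht0]
      have hval := fun T (hT : 0 ≤ T) =>
        utility_feedback_eq hu hF hm hV hsol hcf hAC hb hdc hT
      have hlim : Tendsto (utility ρ u k c) atTop (nhds (V k₀ : EReal)) := by
        have h1 := (tendsto_discountedValue hρ hF hV hkc hb hkd hfF).const_sub (V (k 0))
        rw [sub_zero, h0] at h1
        refine (EReal.tendsto_coe.2 h1).congr' ?_
        filter_upwards [eventually_ge_atTop 0] with T hT
        rw [(hval T hT).2, h0]
      exact ⟨hcb, ⟨fun t ht => ⟨(hpos t ht).le, hc0 t ht⟩, hAC, hcW,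
        fun T hT => Or.inl (hval T hT).1, ⟨_, hlim⟩, h0, hdc⟩, hlim⟩
  · rintro k c ⟨hnn, hAC, -, -, -, h0, hd⟩ hb L hL
    obtain ⟨ε, hε, hkε⟩ := id hb
    have h1 := (tendsto_exp_mul_const hρ (V ε)).const_sub (V k₀)
    rw [sub_zero] at h1
    refine le_of_tendsto_of_tendsto hL (EReal.tendsto_coe.2 h1) ?_
    filter_upwards [eventually_ge_atTop 0] with T hT
    refine (utility_le (k := k) (c := c) hu hF hV hsol (fun t ht => (hnn t ht).2) hAC hb hd
      hT).trans ?_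
    have h0 : k 0 = k₀ := h0
    rw [h0, EReal.coe_le_coe_iff]
    refine sub_le_sub_left (mul_le_mul_of_nonneg_left ?_ (Real.exp_pos _).le) _
    exact hV.increasing.monotoneOn hε (hε.trans_le (hkε T hT)) (hkε T hT)
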